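/- **Model.** Let $W,L\in\mathbb N$ with $L\ge 3$, $N=WL$, and assume $W\ge N^{1/2+\mathfrak c}$ for a fixed $\mathfrak c>0$. Split the $N$ indices into consecutive blocks $\mathcal I_a$, $a\in\mathbb Z_L$, of size $W$, and set $S_{ij}=\frac1{3W}$ if $i\in\mathcal I_a$ and $j\in\mathcal I_{a-1}\cup\mathcal I_a\cup\mathcal I_{a+1}$ for some $a$, and $S_{ij}=0$ otherwise. Let $H_t$ be the Hermitian $N\times N$ matrix Brownian motion $dH_{t,ij}=\sqrt{S_{ij}}\,dB_{t,ij}$, $H_0=0$, at time $t$: the entries $(H_t)_{ij}$, $i\le j$, are independent centered Gaussians with $\mathbb E|(H_t)_{ij}|^2=tS_{ij}$, circular complex for $i<j$ and real for $i=j$. Let $m=m^{(E)}=\lim_{\varepsilon\to0+}m_{sc}(E+i\varepsilon)$, where $m_{sc}(z)=\int\frac{\rho_{sc}(x)}{x-z}\,dx$ and $\rho_{sc}(x)=\frac1{2\pi}\sqrt{(4-x^2)_+}$. Put $$z_t=E+(1-t)m,\qquad \eta_t=\operatorname{Im}z_t,\qquad \ell_t=\min(|1-t|^{-1/2},L),$$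 $$G_t=G_t(+)=(H_t-z_t)^{-1},\qquad G_t(-)=(H_t-\bar z_t)^{-1},\qquad (E_a)_{ij}=\delta_{ij}W^{-1}\mathbf 1(i\in\mathcal I_a).$$ **Loops and chains.** For $\boldsymbol\sigma\in\{+,-\}^k$ and $a_1,\dots,a_k\in\mathbb Z_L$ let $$\mathcal L^{(k)}_{t,\boldsymbol\sigma,\mathbf a}=\operatorname{Tr}\prod_{i=1}^kG_t(\sigma_i)E_{a_i},\qquad \mathcal C^{(k)}_{t,\boldsymbol\sigma,\mathbf a}=G_t(\sigma_1)E_{a_1}G_t(\sigma_2)\cdots E_{a_{k-1}}G_t(\sigma_k),$$ where the chain uses only $a_1,\dots,a_{k-1}$, and $$\Xi^{(\mathcal L)}_{t,k}=\max_{\boldsymbol\sigma,\mathbf a}|\mathcal L^{(k)}_{t,\boldsymbol\sigma,\mathbf a}|\,(W\ell_t\eta_t)^{k-1},$$ $$\Xi^{(\mathcal C,\mathrm{diag})}_{t,k}=\max_{\boldsymbol\sigma,\mathbf a}\max_i|(\mathcal C^{(k)}_{t,\boldsymbol\sigma,\mathbf a})_{ii}|\,(W\ell_t\eta_t)^{k-1},\qquad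 \Xi^{(\mathcal C,\mathrm{off})}_{t,k}=\max_{\boldsymbol\sigma,\mathbf a}\max_{i\ne j}|(\mathcal C^{(k)}_{t,\boldsymbol\sigma,\mathbf a})_{ij}|\,(W\ell_t\eta_t)^{k-1/2}.$$ **Stochastic domination.** All of $W,L,E,t$ may vary with the member of a family of such models. For nonnegative random variables attached to the members, $\xi\prec\zeta$ means: for all $\tau,D>0$ there is $N_0$ such that $\mathbb P(\xi>N^\tau\zeta)\le N^{-D}$ for every member of the family with $N\ge N_0$. **Lemma.** Let $\kappa,\mathfrak c>0$ be fixed, and suppose that $|E|<2-\kappa$ and $0\le t<1$ throughout the family. Assume that $\|G_t-m\|_{\max}=\max_{i,j}|(G_t)_{ij}-m\delta_{ij}|\prec W^{-c}$ for some fixed $c>0$. Let $n\ge1$ be fixed, and let $\alpha,\beta$ be deterministic parameters (possibly depending on the member of the family, but not on $k$ or $n$) with $$\alpha\ge1,\qquad\beta\ge1,\qquad\alpha^2\le(W\ell_t\eta_t)^{1/4}.$$ Suppose that $$\Xi^{(\mathcal L)}_{t,k}\prec f(k,\alpha,\beta):=1+\alpha^{k-1}\beta^{-1}\qquad\text{for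 all }2\le k\le 2n.$$ Then $$\Xi^{(\mathcal C,\mathrm{off})}_{t,n}\prec f(2n,\alpha,\beta)^{1/2}\qquad\text{and}\qquad\Xi^{(\mathcal C,\mathrm{diag})}_{t,2n}\prec f(2n,\alpha,\beta).$$ -/

import Mathlib

open Filter Topology MeasureTheory ProbabilityTheory
open scoped NNReal ENNReal Matrix

namespace BandMatrix

/-! ### The semicircle law and the spectral flow -/

/-- The semicircle density `ρ_sc(x) = (2π)⁻¹ √((4 - x²)₊)`. -/
noncomputable def rhoSC (x : ℝ) : ℝ := (1 / (2 * Real.pi)) * Real.sqrt (max (4 - x ^ 2) 0)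

/-- The Stieltjes transform `m_sc(z) = ∫ ρ_sc(x) / (x - z) dx`. -/
noncomputable def mSC (z : ℂ) : ℂ := ∫ x : ℝ, (rhoSC x : ℂ) / ((x : ℂ) - z)

/-- The boundary value `m^(E) = lim_{ε → 0+} m_sc(E + iε)`. The limit exists for `|E| < 2`:
see `mE_tendsto` and `mE_eq` below. -/
noncomputable def mE (E : ℝ) : ℂ :=
  limUnder (𝓝[>] (0 : ℝ)) (fun ε : ℝ => mSC ((E : ℂ) + (ε : ℂ) * Complex.I))

/-! Evaluation of the Stieltjes transform, which shows that the limit defining `mE` exists. -/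

theorem integral_inv_two_cos_sub {z w : ℂ} (hw0 : w ≠ 0) (hw1 : ‖w‖ < 1)
    (hzw : w ^ 2 + z * w + 1 = 0) :
    ∫ θ : ℝ in (0 : ℝ)..2 * Real.pi, (2 * Complex.cos θ - z)⁻¹ =
      2 * Real.pi * (w / (1 - w ^ 2)) := by
  have hz : z = -(w + w⁻¹) := by
    field_simp
    linear_combination hzw
  have hne : ∀ ζ : ℂ, ‖ζ‖ ≤ 1 → ζ + w⁻¹ ≠ 0 := by
    intro ζ hζ h
    have h1 : ζ = -w⁻¹ := by linear_combination h
    have h2 : ‖ζ‖ = ‖w‖⁻¹ := by rw [h1, norm_neg, norm_inv]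
    have h3 : 1 < ‖w‖⁻¹ := (one_lt_inv₀ (norm_pos_iff.2 hw0)).2 hw1
    linarith
  have hd : DiffContOnCl ℂ (fun ζ : ℂ => (ζ + w⁻¹)⁻¹) (Metric.ball 0 1) := by
    apply DifferentiableOn.diffContOnCl
    intro ζ hζ
    rw [closure_ball _ one_ne_zero] at hζ
    have : ‖ζ‖ ≤ 1 := by simpa using hζ
    have hh := hne ζ this
    have h1 : DifferentiableAt ℂ (fun ζ : ℂ => ζ + w⁻¹) ζ := by fun_prop
    exact (h1.inv hh).differentiableWithinAt
  have hc := hd.circleIntegral_sub_inv_smul (w := -w) (by simpa using hw1)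
  have hw2 : (1 : ℂ) - w ^ 2 ≠ 0 := by
    intro h
    have h1 : w ^ 2 = 1 := by linear_combination -h
    have h2 : ‖w‖ ^ 2 = 1 := by rw [← norm_pow, h1, norm_one]
    nlinarith [norm_nonneg w]
  rw [circleIntegral] at hc
  have hcongr : ∀ θ : ℝ, deriv (circleMap 0 1) θ •
      ((circleMap 0 1 θ - -w)⁻¹ • (circleMap 0 1 θ + w⁻¹)⁻¹) =
      Complex.I * (2 * Complex.cos θ - z)⁻¹ := by
    intro θ
    have hn : ‖circleMap 0 1 θ‖ = 1 := by simp
    have hζ : circleMap 0 1 θ ≠ 0 := by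
      intro h
      rw [h] at hn
      simp at hn
    have h1 : circleMap 0 1 θ + w⁻¹ ≠ 0 := hne _ hn.le
    have h2 : circleMap 0 1 θ - -w ≠ 0 := by
      intro h
      have : circleMap 0 1 θ = -w := by linear_combination h
      rw [this, norm_neg] at hn
      linarith
    have hcos : 2 * Complex.cos θ = circleMap 0 1 θ + (circleMap 0 1 θ)⁻¹ := by
      rw [circleMap_zero, Complex.cos, Complex.ofReal_one, one_mul, ← Complex.exp_neg]
      ring_nf
    have h3 : 2 * Complex.cos θ - z =
        (circleMap 0 1 θ - -w) * (circleMap 0 1 θ + w⁻¹) * (circleMap 0 1 θ)⁻¹ := by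
      rw [hcos, hz]
      field_simp
      ring
    rw [h3, deriv_circleMap, mul_inv, mul_inv, inv_inv]
    simp only [smul_eq_mul]
    ring
  rw [intervalIntegral.integral_congr (g := fun θ : ℝ => Complex.I * (2 * Complex.cos θ - z)⁻¹)
    (fun θ _ => hcongr θ), intervalIntegral.integral_const_mul] at hc
  have h4 : -w + w⁻¹ ≠ 0 := hne _ (by simpa using hw1.le)
  have h5 : (-w + w⁻¹)⁻¹ = w / (1 - w ^ 2) := by
    rw [inv_eq_iff_eq_inv, inv_div]
    field_simp
    ring
  rw [smul_eq_mul, h5] at hc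
  apply mul_left_cancel₀ Complex.I_ne_zero
  rw [hc]
  ring

theorem mSC_eq {z w : ℂ} (hz : 0 < z.im) (hw0 : w ≠ 0) (hw1 : ‖w‖ < 1)
    (hzw : w ^ 2 + z * w + 1 = 0) : mSC z = w := by
  have hne : ∀ x : ℝ, (x : ℂ) - z ≠ 0 := by
    intro x h
    have := congrArg Complex.im h
    simp at this
    linarith
  set g : ℝ → ℂ := fun x => (rhoSC x : ℂ) / ((x : ℂ) - z) with hg
  have hgc : Continuous g := by
    have : Continuous rhoSC := by unfold rhoSC; fun_prop
    refine Continuous.div (Complex.continuous_ofReal.comp this) (by fun_prop) hne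
  have h1 : mSC z = ∫ x in (-2 : ℝ)..2, g x := by
    rw [intervalIntegral.integral_of_le (by norm_num), mSC]
    symm
    apply MeasureTheory.setIntegral_eq_integral_of_forall_compl_eq_zero
    intro x hx
    have : 4 - x ^ 2 ≤ 0 := by
      by_contra h
      push Not at h
      exact hx ⟨by nlinarith, by nlinarith⟩
    simp [hg, rhoSC, max_eq_right this]
  have h2 : ∫ θ in (0 : ℝ)..Real.pi, (-2 * Real.sin θ) • (g ∘ fun θ => 2 * Real.cos θ) θ =
      ∫ x in (2 * Real.cos 0)..(2 * Real.cos Real.pi), g x :=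
    intervalIntegral.integral_deriv_smul_comp (f := fun θ => 2 * Real.cos θ)
      (fun x _ => by
        have := (Real.hasDerivAt_cos x).const_mul 2
        simpa using this) (by fun_prop) hgc
  have h3 : ∀ θ ∈ Set.uIcc 0 Real.pi, (-2 * Real.sin θ) • (g ∘ fun θ => 2 * Real.cos θ) θ =
      -((1 / (2 * Real.pi) : ℝ) : ℂ) *
        ((4 - z ^ 2) * (2 * Complex.cos θ - z)⁻¹ - 2 * Complex.cos θ - z) := by
    intro θ hθ
    rw [Set.uIcc_of_le Real.pi_pos.le] at hθ
    have hs : 0 ≤ Real.sin θ := Real.sin_nonneg_of_nonneg_of_le_pi hθ.1 hθ.2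
    have hr : rhoSC (2 * Real.cos θ) = (1 / (2 * Real.pi)) * (2 * Real.sin θ) := by
      unfold rhoSC
      congr 1
      have : 4 - (2 * Real.cos θ) ^ 2 = (2 * Real.sin θ) ^ 2 := by
        nlinarith [Real.sin_sq_add_cos_sq θ]
      rw [this, max_eq_left (sq_nonneg _), Real.sqrt_sq (by positivity)]
    have hn : 2 * Complex.cos θ - z ≠ 0 := by
      have := hne (2 * Real.cos θ)
      simpa using this
    simp only [hg, Function.comp, hr, Complex.real_smul]
    push_cast
    have hsc := Complex.sin_sq_add_cos_sq (θ : ℂ)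
    have hpi : (Real.pi : ℂ) ≠ 0 := by exact_mod_cast Real.pi_ne_zero
    field_simp
    linear_combination (-4 : ℂ) * hsc
  have hcont : Continuous fun θ : ℝ => (2 * Complex.cos θ - z)⁻¹ := by
    refine Continuous.inv₀ (by fun_prop) ?_
    intro θ
    simpa using hne (2 * Real.cos θ)
  have h4 : ∫ θ : ℝ in (0 : ℝ)..Real.pi, (2 * Complex.cos θ - z)⁻¹ =
      Real.pi * (w / (1 - w ^ 2)) := by
    have h := integral_inv_two_cos_sub hw0 hw1 hzw
    rw [← intervalIntegral.integral_add_adjacent_intervals (b := Real.pi)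
      (hcont.intervalIntegrable _ _) (hcont.intervalIntegrable _ _)] at h
    have hsym : ∫ θ : ℝ in Real.pi..2 * Real.pi, (2 * Complex.cos θ - z)⁻¹ =
        ∫ θ : ℝ in (0 : ℝ)..Real.pi, (2 * Complex.cos θ - z)⁻¹ := by
      have := intervalIntegral.integral_comp_sub_left (a := 0) (b := Real.pi)
        (fun θ : ℝ => (2 * Complex.cos θ - z)⁻¹) (2 * Real.pi)
      rw [sub_zero, show 2 * Real.pi - Real.pi = Real.pi by ring] at this
      rw [← this]
      congr 1
      ext θ
      congr 2
      push_cast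
      rw [Complex.cos_two_pi_sub]
    rw [hsym] at h
    linear_combination (1 / 2 : ℂ) * h
  have hcosint : ∫ θ : ℝ in (0 : ℝ)..Real.pi, 2 * Complex.cos θ = 0 := by
    have : ∫ θ : ℝ in (0 : ℝ)..Real.pi, ((2 * Real.cos θ : ℝ) : ℂ) = 0 := by
      rw [intervalIntegral.integral_ofReal, intervalIntegral.integral_const_mul, integral_cos]
      simp
    simpa using this
  have hw2 : (1 : ℂ) - w ^ 2 ≠ 0 := by
    intro h
    have h1 : w ^ 2 = 1 := by linear_combination -h
    have h2 : ‖w‖ ^ 2 = 1 := by rw [← norm_pow, h1, norm_one]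
    nlinarith [norm_nonneg w]
  rw [intervalIntegral.integral_congr h3, intervalIntegral.integral_const_mul,
    intervalIntegral.integral_sub, intervalIntegral.integral_sub,
    intervalIntegral.integral_const_mul, h4, hcosint] at h2
  · simp only [Real.cos_zero, Real.cos_pi, mul_one, mul_neg, intervalIntegral.integral_const,
      sub_zero, Complex.real_smul] at h2
    rw [intervalIntegral.integral_symm, ← h1] at h2
    have hpi : (Real.pi : ℂ) ≠ 0 := by exact_mod_cast Real.pi_ne_zero
    have hz' : z = -(w + w⁻¹) := by
      field_simp
      linear_combination hzw
    have h6 : mSC z = (1 / 2) * ((4 - z ^ 2) * (w / (1 - w ^ 2)) - z) := by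
      have h7 := congrArg (fun y => -y) h2
      simp only [neg_neg] at h7
      rw [← h7]
      push_cast
      field_simp
    rw [h6, hz']
    field_simp
    ring
  all_goals
    apply Continuous.intervalIntegrable
    fun_prop

theorem mE_tendsto {E : ℝ} (hE : |E| < 2) :
    Tendsto (fun ε : ℝ => mSC ((E : ℂ) + (ε : ℂ) * Complex.I)) (𝓝[>] (0 : ℝ))
      (𝓝 ((-(E : ℂ) + (Real.sqrt (4 - E ^ 2) : ℂ) * Complex.I) / 2)) := by
  have hpos : 0 < 4 - E ^ 2 := by
    have := abs_lt.1 hE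
    nlinarith
  set s : ℝ → ℂ := fun ε => (4 - ((E : ℂ) + (ε : ℂ) * Complex.I) ^ 2) ^ (1 / 2 : ℂ) with hs
  set w : ℝ → ℂ := fun ε => (-((E : ℂ) + (ε : ℂ) * Complex.I) + s ε * Complex.I) / 2 with hw
  have hs0 : s 0 = (Real.sqrt (4 - E ^ 2) : ℂ) := by
    simp only [hs, Complex.ofReal_zero, zero_mul, add_zero]
    rw [Real.sqrt_eq_rpow, Complex.ofReal_cpow hpos.le]
    push_cast
    rfl
  have hsc : ContinuousAt s 0 := by
    refine ContinuousAt.cpow (by fun_prop) continuousAt_const ?_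
    have h0 : (4 : ℂ) - ((E : ℂ) + ((0 : ℝ) : ℂ) * Complex.I) ^ 2 = ((4 - E ^ 2 : ℝ) : ℂ) := by
      push_cast
      ring
    rw [h0]
    exact Complex.ofReal_mem_slitPlane.2 hpos
  have hwc : ContinuousAt w 0 := by
    simp only [hw]
    fun_prop
  have hw0 : w 0 = (-(E : ℂ) + (Real.sqrt (4 - E ^ 2) : ℂ) * Complex.I) / 2 := by
    simp [hw, hs0]
  have him : ∀ᶠ ε in 𝓝 (0 : ℝ), 0 < (w ε).im := by
    refine (Complex.continuous_im.continuousAt.comp hwc).eventually (lt_mem_nhds ?_)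
    simp only [Function.comp, hw0]
    simp
    have := Real.sqrt_pos.2 hpos
    linarith
  rw [← hw0]
  refine (hwc.tendsto.mono_left nhdsWithin_le_nhds).congr' ?_
  filter_upwards [self_mem_nhdsWithin, him.filter_mono nhdsWithin_le_nhds] with ε hε hi
  symm
  have hq : (w ε) ^ 2 + ((E : ℂ) + (ε : ℂ) * Complex.I) * w ε + 1 = 0 := by
    have hss : s ε ^ 2 = 4 - ((E : ℂ) + (ε : ℂ) * Complex.I) ^ 2 := by
      simp only [hs]
      rw [← Complex.cpow_nat_mul]
      norm_num
    have h2 : 2 * w ε + ((E : ℂ) + (ε : ℂ) * Complex.I) = s ε * Complex.I := by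
      simp only [hw]; ring
    have h3 := congrArg (fun y => y ^ 2) h2
    simp only [mul_pow, Complex.I_sq, hss] at h3
    linear_combination (1 / 4 : ℂ) * h3
  have hwne : w ε ≠ 0 := by
    intro h
    rw [h] at hi
    simp at hi
  have hzim : ((E : ℂ) + (ε : ℂ) * Complex.I).im = ε := by simp
  refine mSC_eq (by rw [hzim]; exact hε) hwne ?_ hq
  have hz : (E : ℂ) + (ε : ℂ) * Complex.I = -(w ε + (w ε)⁻¹) := by
    field_simp
    linear_combination hq
  have h5 := congrArg Complex.im hz
  rw [hzim, Complex.neg_im, Complex.add_im, Complex.inv_im] at h5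
  have hn : 0 < Complex.normSq (w ε) := Complex.normSq_pos.2 hwne
  have hε' : 0 < ε := hε
  have h6 : (w ε).im < (w ε).im / Complex.normSq (w ε) := by
    rw [neg_div] at h5
    linarith
  have h7 : Complex.normSq (w ε) < 1 := by
    rw [lt_div_iff₀ hn] at h6
    nlinarith
  rw [Complex.normSq_eq_norm_sq] at h7
  nlinarith [norm_nonneg (w ε)]

theorem mE_eq {E : ℝ} (hE : |E| < 2) :
    mE E = (-(E : ℂ) + (Real.sqrt (4 - E ^ 2) : ℂ) * Complex.I) / 2 :=
  (mE_tendsto hE).limUnder_eq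

/-- The flow `z_t = E + (1 - t) m^(E)`. -/
noncomputable def zFlow (E t : ℝ) : ℂ := (E : ℂ) + ((1 - t : ℝ) : ℂ) * mE E

/-- `η_t = Im z_t`. -/
noncomputable def etaFlow (E t : ℝ) : ℝ := (zFlow E t).im

/-- `ℓ_t = min(|1 - t|^(-1/2), L)`. -/
noncomputable def ellFlow (L : ℕ) (t : ℝ) : ℝ := min (|1 - t| ^ (-(1 / 2) : ℝ)) (L : ℝ)

/-- The scale `W ℓ_t η_t`. -/
noncomputable def scale (L W : ℕ) (E t : ℝ) : ℝ := (W : ℝ) * ellFlow L t * etaFlow E t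

/-! ### The block band matrix -/

/-- Matrix indices: `(a, k)` is the `k`-th site of the block `a`, with `L` blocks on a cycle and
`W` sites in each block, so that there are `N = W * L` indices. -/
abbrev Idx (L W : ℕ) : Type := ZMod L × Fin W

/-- The position of an index in the linear order `0, 1, ..., N - 1`, block after block. -/
def pos (L W : ℕ) (i : Idx L W) : ℕ := i.1.val * W + i.2.val

/-- The variance profile: `S_ij = 1 / (3W)` if the blocks of `i` and `j` are equal or
neighbours on the cycle, and `S_ij = 0` otherwise. -/
noncomputable def varS (L W : ℕ) (i j : Idx L W) : ℝ :=
  if j.1 = i.1 ∨ j.1 = i.1 + 1 ∨ j.1 = i.1 - 1 then 1 / (3 * (W : ℝ)) else 0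

/-- The circular complex Gaussian law `CN(0, v)`: independent real and imaginary parts, each
`N(0, v / 2)`. -/
noncomputable def complexGaussian (v : ℝ≥0) : Measure ℂ :=
  ((gaussianReal 0 (v / 2)).prod (gaussianReal 0 (v / 2))).map
    (fun p : ℝ × ℝ => (p.1 : ℂ) + (p.2 : ℂ) * Complex.I)

/-- `H` has the law, at time `t`, of the Hermitian matrix Brownian motion
`dH_ij = √S_ij dB_ij`, `H_0 = 0`: the matrix is Hermitian, its entries on and above the diagonal
are independent, the ones above it are `CN(0, t S_ij)`, the ones on it are real `N(0, t S_ii)`. -/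
structure IsBandMatrixAt (L W : ℕ) (t : ℝ) {Ω : Type*} [MeasurableSpace Ω] (P : Measure Ω)
    (H : Ω → Matrix (Idx L W) (Idx L W) ℂ) : Prop where
  isHermitian : ∀ ω, (H ω).IsHermitian
  law_diag : ∀ i, HasLaw (fun ω => H ω i i)
    ((gaussianReal 0 (t * varS L W i i).toNNReal).map (fun x : ℝ => (x : ℂ))) P
  law_offDiag : ∀ i j, i ≠ j →
    HasLaw (fun ω => H ω i j) (complexGaussian (t * varS L W i j).toNNReal) P
  indep : iIndepFun
    (fun (p : {p : Idx L W × Idx L W // pos L W p.1 ≤ pos L W p.2}) (ω : Ω) =>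
      H ω p.1.1 p.1.2) P

/-- The block projection `(E_a)_ij = δ_ij W⁻¹ 1(i ∈ I_a)`. -/
noncomputable def blockE (L W : ℕ) (a : ZMod L) : Matrix (Idx L W) (Idx L W) ℂ :=
  Matrix.diagonal (fun i => if i.1 = a then ((W : ℂ))⁻¹ else 0)

section Observables

variable (L W : ℕ) [NeZero L]

/-- The resolvents `G(+) = (H - z)⁻¹` (sign `true`) and `G(-) = (H - z̄)⁻¹` (sign `false`). -/
noncomputable def green (H : Matrix (Idx L W) (Idx L W) ℂ) (z : ℂ) (s : Bool) :
    Matrix (Idx L W) (Idx L W) ℂ :=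
  if s then (H - z • (1 : Matrix (Idx L W) (Idx L W) ℂ))⁻¹
  else (H - (starRingEnd ℂ z) • (1 : Matrix (Idx L W) (Idx L W) ℂ))⁻¹

/-- `‖A‖_max = max_{i,j} |A_ij|`. -/
noncomputable def maxNorm (A : Matrix (Idx L W) (Idx L W) ℂ) : ℝ := ⨆ i, ⨆ j, ‖A i j‖

/-- The `m`-loop `tr (G(σ_1) E_{a_1} ⋯ G(σ_m) E_{a_m})`. -/
noncomputable def gLoop (H : Matrix (Idx L W) (Idx L W) ℂ) (z : ℂ) {m : ℕ}
    (σ : Fin m → Bool) (a : Fin m → ZMod L) : ℂ :=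
  (List.ofFn (fun k : Fin m => green L W H z (σ k) * blockE L W (a k))).prod.trace

/-- The chain `G(σ_0) E_{a_0} G(σ_1) E_{a_1} ⋯ E_{a_{k-1}} G(σ_k)`, with `k + 1` resolvents. -/
noncomputable def gChain (H : Matrix (Idx L W) (Idx L W) ℂ) (z : ℂ) {k : ℕ}
    (σ : Fin (k + 1) → Bool) (a : Fin k → ZMod L) : Matrix (Idx L W) (Idx L W) ℂ :=
  green L W H z (σ 0) *
    (List.ofFn (fun j : Fin k => blockE L W (a j) * green L W H z (σ j.succ))).prod

/-- `Ξ^(L)_{t,m} = max_{σ,a} |L_{t,σ,a}| (W ℓ_t η_t)^(m-1)`, used for `m ≥ 1`. -/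
noncomputable def XiLoop (H : Matrix (Idx L W) (Idx L W) ℂ) (E t : ℝ) (m : ℕ) : ℝ :=
  (⨆ σ : Fin m → Bool, ⨆ a : Fin m → ZMod L, ‖gLoop L W H (zFlow E t) σ a‖) *
    scale L W E t ^ ((m : ℝ) - 1)

/-- `Ξ^(C,diag)_{t,m} = max_{σ,a} max_i |(C^(m)_{t,σ,a})_ii| (W ℓ_t η_t)^(m-1)`, used for
`m ≥ 1`; a chain of length `m` has `m - 1` block projections. -/
noncomputable def XiDiag (H : Matrix (Idx L W) (Idx L W) ℂ) (E t : ℝ) (m : ℕ) : ℝ :=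
  (⨆ σ : Fin ((m - 1) + 1) → Bool, ⨆ a : Fin (m - 1) → ZMod L, ⨆ i : Idx L W,
    ‖gChain L W H (zFlow E t) σ a i i‖) * scale L W E t ^ ((m : ℝ) - 1)

/-- `Ξ^(C,off)_{t,m} = max_{σ,a} max_{i≠j} |(C^(m)_{t,σ,a})_ij| (W ℓ_t η_t)^(m-1/2)`, used for
`m ≥ 1`. -/
noncomputable def XiOff (H : Matrix (Idx L W) (Idx L W) ℂ) (E t : ℝ) (m : ℕ) : ℝ :=
  (⨆ σ : Fin ((m - 1) + 1) → Bool, ⨆ a : Fin (m - 1) → ZMod L,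
    ⨆ p : {p : Idx L W × Idx L W // p.1 ≠ p.2},
      ‖gChain L W H (zFlow E t) σ a p.1.1 p.1.2‖) * scale L W E t ^ ((m : ℝ) - 1 / 2)

end Observables

/-- `f(m, α, β) = 1 + α^(m-1) β⁻¹`, used for `m ≥ 1`. -/
noncomputable def fBound (m : ℕ) (α β : ℝ) : ℝ := 1 + α ^ (m - 1) * β⁻¹

/-- Stochastic domination `ξ ≺ ζ` for a family of models indexed by `ι`, the `i`-th one of size
`N i` and living on its own probability space: for all `τ, D > 0` there is `N₀` such that
`P(ξ > N^τ ζ) ≤ N^(-D)` for every member of the family with `N ≥ N₀`. -/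
def StochDom {ι : Type*} {Ω : ι → Type*} [∀ i, MeasurableSpace (Ω i)]
    (P : ∀ i, Measure (Ω i)) (N : ι → ℕ) (ξ ζ : ∀ i, Ω i → ℝ) : Prop :=
  ∀ τ : ℝ, 0 < τ → ∀ D : ℝ, 0 < D → ∃ N₀ : ℕ, ∀ i, N₀ ≤ N i →
    (P i).real {ω | ξ i ω > (N i : ℝ) ^ τ * ζ i ω} ≤ (N i : ℝ) ^ (-D)

end BandMatrix

open BandMatrix

/-! The argument removes one row and column. For an index i, let `minor G i` be G - G e_i e_iᵀ G /
G_ii, the resolvent of H with row and column i cut out. It is a function of the entries of H outside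
row and column i, hence independent of row i (`minor_eq_inv`, `IsBandMatrixAt.indepFun_row_cut`).
Exchanging the factors of a chain for minors one at a time, from the left, gives
`chain_minor_apply`. In row i the chain of minors vanishes, so `chain_row_apply` writes row i of a
chain as a sum of diagonal entries of prefixes times rows of mixed chains. A mixed row is -G_ii
times the row H_i applied to a chain of minors (`mixedChain_row`). Gaussian concentration
(`IsBandMatrixAt.row_concentration`) therefore bounds its square by ∑ S_ix |(minor chain)_xk|², up
to a factor B = N^θ, and this sum is dominated by averages over blocks.

Two quantities are then bounded together by induction on the length p + 1 of the chains: X, the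
block average of |C_ik|² over k, and Y, the average over two blocks of the squared entries of the
chain of minors. Up to powers of B, the identities give X ≤ Y + (shorter chains) and Y ≤ (loop) + δ
(X + Y) + (shorter chains). The average of |C_xy|² over two blocks is a loop with 2p + 2 resolvents
(`exists_gLoop_eq`), so the hypothesis controls it. The factor δ comes from the entrywise bound on G
- m and beats the powers of B, so the system closes (`GoodSample.row_minor_step`). The sizes are Q_j
= (1 + α^j β⁻¹) (W ℓ η)^(-j). They satisfy Q_j Q_k ≤ 3 Q_(j+k), so products of shorter chains have
the size required of the long one.

A diagonal entry of a chain with 2n resolvents is split in the middle and bounded by Cauchy–Schwarz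
from two row averages (`GoodSample.diag_even_bound`). For an off-diagonal entry (i, j) the same
recursion is run with the point mass at j in place of the block average (`GoodSample.entry_step`).
All this is deterministic on a `GoodSample`. Each induction step raises the accumulated constant to
the ninth power, so the total loss is a power of B depending only on n, and θ is chosen small enough
to make it at most N^τ. -/

namespace BandMatrix

/-! ### Algebra of resolvent chains and their minors -/

section ChainAlgebra

variable {I A : Type*} [Fintype I] [DecidableEq I]

/-- The chain `G(s) E_{a_1} G(s_1) E_{a_2} ⋯ G(s_k)` along the list `(a_1, s_1), …, (a_k, s_k)`. -/
def chain (E : A → Matrix I I ℂ) (G : Bool → Matrix I I ℂ) :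
    Bool → List (A × Bool) → Matrix I I ℂ
  | s, [] => G s
  | s, p :: l => G s * E p.1 * chain E G p.2 l

/-- The chain whose first factor is taken from `G` and the others from `K`. -/
def mixedChain (E : A → Matrix I I ℂ) (G K : Bool → Matrix I I ℂ) :
    Bool → List (A × Bool) → Matrix I I ℂ
  | s, [] => G s
  | s, p :: l => G s * E p.1 * chain E K p.2 l

/-- The last sign of a chain. -/
def lastSign : Bool → List (A × Bool) → Bool
  | s, [] => s
  | _, p :: l => lastSign p.2 l

/-- The resolvent minor `G - G e_i e_iᵀ G / G_ii`. -/
noncomputable def minor (G : Bool → Matrix I I ℂ) (i : I) (s : Bool) : Matrix I I ℂ :=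
  G s - G s * Matrix.single i i (G s i i)⁻¹ * G s

omit [DecidableEq I] in
theorem chain_cons (E : A → Matrix I I ℂ) (G : Bool → Matrix I I ℂ) (s : Bool) (p : A × Bool)
    (l : List (A × Bool)) : chain E G s (p :: l) = G s * E p.1 * chain E G p.2 l := rfl

omit [DecidableEq I] in
theorem mixedChain_cons (E : A → Matrix I I ℂ) (G K : Bool → Matrix I I ℂ) (s : Bool)
    (p : A × Bool) (l : List (A × Bool)) :
    mixedChain E G K s (p :: l) = G s * E p.1 * chain E K p.2 l := rfl

omit [DecidableEq I] in
theorem chain_append (E : A → Matrix I I ℂ) (G : Bool → Matrix I I ℂ) (s : Bool)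
    (l : List (A × Bool)) (p : A × Bool) (l' : List (A × Bool)) :
    chain E G s (l ++ p :: l') = chain E G s l * E p.1 * chain E G p.2 l' := by
  induction l generalizing s with
  | nil => rfl
  | cons q l ih => simp only [List.cons_append, chain, ih, Matrix.mul_assoc]

omit [DecidableEq I] in
theorem exists_chain_conjTranspose (E : A → Matrix I I ℂ) (G : Bool → Matrix I I ℂ)
    (hE : ∀ a, (E a)ᴴ = E a) (hG : ∀ s, (G s)ᴴ = G (!s)) (s : Bool) (l : List (A × Bool)) :
    ∃ s' l', l'.length = l.length ∧ (chain E G s l)ᴴ = chain E G s' l' := by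
  induction l generalizing s with
  | nil => exact ⟨!s, [], rfl, hG s⟩
  | cons p l ih =>
    obtain ⟨s', l', hl, h⟩ := ih p.2
    refine ⟨s', l' ++ [(p.1, !s)], by simp [hl], ?_⟩
    rw [chain_append, chain_cons, Matrix.conjTranspose_mul, Matrix.conjTranspose_mul, h, hE, hG]
    simp only [chain, Matrix.mul_assoc]

/-- Telescoping: the minors are replaced by G from the left. Replacing the factor number k leaves
the rank-one correction, with G in all factors before it, one G on either side of e_i e_iᵀ, and
minors in all factors after it. -/
theorem chain_minor (E : A → Matrix I I ℂ) (G : Bool → Matrix I I ℂ) (i : I) (s : Bool)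
    (l : List (A × Bool)) :
    chain E (minor G i) s l = chain E G s l - ∑ k ∈ Finset.range (l.length + 1),
      chain E G s (l.take k) * Matrix.single i i (G (lastSign s (l.take k))
        i i)⁻¹ * mixedChain E G (minor G i) (lastSign s (l.take k)) (l.drop k) := by
  induction l generalizing s with
  | nil => simp [chain, mixedChain, lastSign, minor]
  | cons p l ih =>
    -- The term k = 0 is the correction from the first factor; the others are the induction
    -- hypothesis multiplied from the left.
    rw [Finset.sum_range_succ']
    simp only [List.take_succ_cons, List.drop_succ_cons, List.take_zero, List.drop_zero,
      chain_cons, lastSign, List.length_cons, mixedChain_cons]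
    have h : G s * E p.1 * chain E G p.2 l = G s * E p.1 * chain E (minor G i) p.2 l +
        ∑ k ∈ Finset.range (l.length + 1), G s * E p.1 * chain E G p.2 (l.take k) *
          Matrix.single i i (G (lastSign p.2 (l.take k)) i i)⁻¹ *
          mixedChain E G (minor G i) (lastSign p.2 (l.take k)) (l.drop k) := by
      rw [ih p.2, Matrix.mul_sub, Finset.mul_sum]
      simp only [Matrix.mul_assoc, sub_add_cancel]
    rw [h]
    simp only [minor, Matrix.sub_mul, Matrix.mul_assoc]
    simp only [chain]
    abel

theorem mul_single_mul_apply (M N : Matrix I I ℂ) (i : I) (c : ℂ) (x y : I) :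
    (M * Matrix.single i i c * N) x y = M x i * c * N i y := by
  rw [Matrix.mul_apply, Finset.sum_eq_single i]
  · simp
  · intro j _ hj
    simp [Matrix.mul_single_apply_of_ne, hj]
  · simp

theorem minor_apply (G : Bool → Matrix I I ℂ) (i : I) (s : Bool) (x y : I) :
    minor G i s x y = G s x y - G s x i * (G s i i)⁻¹ * G s i y := by
  rw [minor, Matrix.sub_apply, mul_single_mul_apply]

theorem minor_row {G : Bool → Matrix I I ℂ} {i : I} {s : Bool} (h : G s i i ≠ 0) (y : I) :
    minor G i s i y = 0 := by
  rw [minor_apply, mul_inv_cancel₀ h, one_mul, sub_self]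

theorem chain_minor_row {E : A → Matrix I I ℂ} {G : Bool → Matrix I I ℂ} {i : I}
    (h : ∀ s, G s i i ≠ 0) (s : Bool) (l : List (A × Bool)) (y : I) :
    chain E (minor G i) s l i y = 0 := by
  cases l with
  | nil => exact minor_row (h s) y
  | cons p l =>
    rw [chain, Matrix.mul_assoc, Matrix.mul_apply]
    simp [minor_row (h s)]

theorem chain_minor_apply (E : A → Matrix I I ℂ) (G : Bool → Matrix I I ℂ) (i : I) (s : Bool)
    (l : List (A × Bool)) (x y : I) :
    chain E (minor G i) s l x y = chain E G s l x y - ∑ k ∈ Finset.range (l.length + 1),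
      chain E G s (l.take k) x i * (G (lastSign s (l.take k)) i i)⁻¹ *
        mixedChain E G (minor G i) (lastSign s (l.take k)) (l.drop k) i y := by
  rw [chain_minor, Matrix.sub_apply, Matrix.sum_apply]
  simp only [mul_single_mul_apply]

/-- The case x = i of `chain_minor_apply`, where the left-hand side vanishes because row i of a
minor is zero. -/
theorem chain_row_apply {E : A → Matrix I I ℂ} {G : Bool → Matrix I I ℂ} {i : I}
    (h : ∀ s, G s i i ≠ 0) (s : Bool) (l : List (A × Bool)) (y : I) :
    chain E G s l i y = ∑ k ∈ Finset.range (l.length + 1),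
      chain E G s (l.take k) i i * (G (lastSign s (l.take k)) i i)⁻¹ *
        mixedChain E G (minor G i) (lastSign s (l.take k)) (l.drop k) i y := by
  have h1 := chain_minor_apply E G i s l i y
  rw [chain_minor_row h] at h1
  exact (sub_eq_zero.1 h1.symm)

/-- The row `i` of a resolvent in terms of the row `i` of `H` and the resolvent minor. -/
theorem resolvent_row {G : Bool → Matrix I I ℂ} {i : I} {s : Bool} {H : Matrix I I ℂ} {ζ : ℂ}
    (h : G s i i ≠ 0) (hG : (H - ζ • (1 : Matrix I I ℂ)) * G s = 1) {k : I} (hk : k ≠ i) :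
    G s i k = -(G s i i * ∑ x, H i x * minor G i s x k) := by
  -- Its entry (i, k) is the claim: on the left only H contributes, since row i of the minor is
  -- zero.
  have h1 : (H - ζ • (1 : Matrix I I ℂ)) * minor G i s =
      1 - 1 * Matrix.single i i (G s i i)⁻¹ * G s := by
    rw [minor, Matrix.mul_sub, ← Matrix.mul_assoc, ← Matrix.mul_assoc, hG]
  have h2 := congrFun (congrFun h1 i) k
  rw [Matrix.sub_apply, mul_single_mul_apply, Matrix.sub_mul, Matrix.sub_apply, Matrix.smul_mul,
    Matrix.one_mul, Matrix.smul_apply, minor_row h, Matrix.one_apply_ne hk.symm,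
    Matrix.one_apply_eq, Matrix.mul_apply] at h2
  simp only [smul_zero, sub_zero, zero_sub, one_mul] at h2
  rw [h2]
  field_simp

/-- Only the first factor of a mixed chain sees row i of H. Expanding its row by `resolvent_row`
turns it into a minor, so the row H_i is paired with a quantity independent of it. -/
theorem mixedChain_row {w : A → I → ℂ} {G : Bool → Matrix I I ℂ} {i : I}
    {H : Matrix I I ℂ} {ζ : Bool → ℂ} (h : ∀ s, G s i i ≠ 0)
    (hG : ∀ s, (H - ζ s • (1 : Matrix I I ℂ)) * G s = 1) (s : Bool) (l : List (A × Bool))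
    {k : I} (hk : k ≠ i) :
    mixedChain (fun a => Matrix.diagonal (w a)) G (minor G i) s l i k =
      -(G s i i * ∑ x, H i x * chain (fun a => Matrix.diagonal (w a)) (minor G i) s l x k) := by
  cases l with
  | nil => exact resolvent_row (h s) (hG s) hk
  | cons p l =>
    rw [mixedChain, Matrix.mul_assoc, Matrix.mul_apply]
    have h0 : ∀ x, (Matrix.diagonal (w p.1) * chain (fun a => Matrix.diagonal (w a))
        (minor G i) p.2 l) x k = w p.1 x * chain (fun a => Matrix.diagonal (w a))
        (minor G i) p.2 l x k := fun x => Matrix.diagonal_mul _ _ _ _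
    simp only [chain, Matrix.mul_assoc, h0]
    have h1 : ∀ x, G s i x * (w p.1 x * chain (fun a => Matrix.diagonal (w a))
        (minor G i) p.2 l x k) = -(G s i i * ∑ y, H i y * (minor G i s y x *
        (w p.1 x * chain (fun a => Matrix.diagonal (w a)) (minor G i) p.2 l x k))) := by
      intro x
      -- `resolvent_row` needs x ≠ i; at x = i both sides vanish because the remaining chain of
      -- minors has zero row i.
      by_cases hx : x = i
      · subst hx
        simp [chain_minor_row h]
      · rw [resolvent_row (h s) (hG s) hx, neg_mul, mul_assoc, Finset.sum_mul]
        simp only [mul_assoc]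
    rw [Finset.sum_congr rfl fun x _ => h1 x, Finset.sum_neg_distrib, ← Finset.mul_sum,
      Finset.sum_comm]
    congr 2
    refine Finset.sum_congr rfl fun y _ => ?_
    rw [← Finset.mul_sum, Matrix.mul_apply]
    simp only [h0]

end ChainAlgebra

/-! ### Deterministic inequalities on a good sample -/

section Deterministic

theorem norm_sub_sum_sq_le (a : ℂ) (b : ℕ → ℂ) (n : ℕ) :
    ‖a - ∑ k ∈ Finset.range n, b k‖ ^ 2 ≤
      ((n : ℝ) + 1) * (‖a‖ ^ 2 + ∑ k ∈ Finset.range n, ‖b k‖ ^ 2) := by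
  have h1 : ‖a - ∑ k ∈ Finset.range n, b k‖ ≤ ‖a‖ + ∑ k ∈ Finset.range n, ‖b k‖ :=
    (norm_sub_le _ _).trans (by gcongr; exact norm_sum_le _ _)
  have h2 : (∑ k ∈ Finset.range n, ‖b k‖) ^ 2 ≤ (n : ℝ) * ∑ k ∈ Finset.range n, ‖b k‖ ^ 2 := by
    simpa using sq_sum_le_card_mul_sum_sq (s := Finset.range n) (f := fun k => ‖b k‖)
  set T := ∑ k ∈ Finset.range n, ‖b k‖
  set Q := ∑ k ∈ Finset.range n, ‖b k‖ ^ 2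
  have hT : 0 ≤ T := Finset.sum_nonneg fun _ _ => norm_nonneg _
  have hQ : 0 ≤ Q := Finset.sum_nonneg fun _ _ => sq_nonneg _
  have h3 : ‖a - ∑ k ∈ Finset.range n, b k‖ ^ 2 ≤ (‖a‖ + T) ^ 2 := by gcongr
  refine h3.trans ?_
  rcases Nat.eq_zero_or_pos n with hn | hn
  · subst hn
    simp only [T, Q, Finset.range_zero, Finset.sum_empty]
    simp
  · have hn' : (0 : ℝ) < n := by exact_mod_cast hn
    have h4 : 2 * ‖a‖ * T ≤ n * ‖a‖ ^ 2 + T ^ 2 / n := by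
      have : n * ‖a‖ ^ 2 + T ^ 2 / n - 2 * ‖a‖ * T = (n * ‖a‖ - T) ^ 2 / n := by
        field_simp
        ring
      have h5 : 0 ≤ (n * ‖a‖ - T) ^ 2 / (n : ℝ) := by positivity
      linarith
    have h5 : T ^ 2 / n ≤ Q := by
      rw [div_le_iff₀ hn']
      linarith
    nlinarith

theorem norm_sum_sq_le (b : ℕ → ℂ) (n : ℕ) :
    ‖∑ k ∈ Finset.range n, b k‖ ^ 2 ≤ (n : ℝ) * ∑ k ∈ Finset.range n, ‖b k‖ ^ 2 := by
  have h1 : ‖∑ k ∈ Finset.range n, b k‖ ^ 2 ≤ (∑ k ∈ Finset.range n, ‖b k‖) ^ 2 := by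
    gcongr
    exact norm_sum_le _ _
  refine h1.trans ?_
  simpa using sq_sum_le_card_mul_sum_sq (s := Finset.range n) (f := fun k => ‖b k‖)

/-- Applied to y = max F, the self-bound reads max F ≤ a + max F / 2, and the half is absorbed.
Finiteness of T provides the a priori finite maximum. -/
theorem le_two_mul_of_self_bound {T : Type*} [Finite T] (F : T → ℝ) (a : ℝ)
    (h : ∀ y, (∀ t, F t ≤ y) → ∀ t, F t ≤ a + y / 2) (t : T) : F t ≤ 2 * a := by
  have : Nonempty T := ⟨t⟩
  obtain ⟨t₀, ht₀⟩ := Finite.exists_max F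
  have := h _ ht₀ t₀
  have := ht₀ t
  linarith

variable {I A : Type*} [Fintype I] [DecidableEq I]

/-- The diagonal matrices with real diagonals `w a`. -/
noncomputable def weightE (w : A → I → ℝ) (a : A) : Matrix I I ℂ :=
  Matrix.diagonal (fun k => (w a k : ℂ))

/-- The deterministic conditions on the resolvents `G` of `H` under which resolvent chains are
controlled: an entrywise a priori bound, concentration of the rows of `H` against the chains of
minors, and bounds on the symmetric loops. -/
structure GoodSample (w : A → I → ℝ) (S : I → I → ℝ) (H : Matrix I I ℂ)
    (G : Bool → Matrix I I ℂ) (n : ℕ) (B δ r : ℝ) (Q : ℕ → ℝ) : Prop where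
  w_nonneg : ∀ a k, 0 ≤ w a k
  w_le : ∀ a k, w a k ≤ r
  adj : ∀ s, (G s)ᴴ = G (!s)
  res : ∃ ζ : Bool → ℂ, ∀ s, (H - ζ s • (1 : Matrix I I ℂ)) * G s = 1
  diag_ge : ∀ s i, 1 / 2 ≤ ‖G s i i‖
  diag_le : ∀ s i, ‖G s i i‖ ≤ 2
  off_le : ∀ s i j, i ≠ j → ‖G s i j‖ ^ 2 ≤ δ
  avg_le : ∀ s i a, ∑ k, w a k * ‖G s i k‖ ^ 2 ≤ δ
  -- A row of S is dominated by an average of block weights.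
  var_le : ∀ i (f : I → ℝ) (y : ℝ), (∀ x, 0 ≤ f x) → (∀ c, ∑ x, w c x * f x ≤ y) →
    ∑ x, S i x * f x ≤ y
  lde : ∀ i k, k ≠ i → ∀ s (l : List (A × Bool)), l.length < n →
    ‖∑ x, H i x * chain (weightE w) (minor G i) s l x k‖ ^ 2 ≤
      B * ∑ x, S i x * ‖chain (weightE w) (minor G i) s l x k‖ ^ 2
  loop : ∀ s (l : List (A × Bool)), l.length < n → ∀ a b,
    ∑ x, w a x * ∑ y, w b y * ‖chain (weightE w) G s l x y‖ ^ 2 ≤ B * Q (2 * l.length + 1)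
  -- Q j is the size of a loop with j + 1 resolvents, so Q (2p + 1) is the target for squared
  -- entries of chains with p + 1 resolvents.
  Q_nonneg : ∀ j, 0 ≤ Q j
  Q_zero : 1 ≤ Q 0
  Q_succ : ∀ j, Q (j + 1) ≤ Q j
  Q_mul : ∀ j k, Q j * Q k ≤ 3 * Q (j + k)
  Q_r : ∀ j, r * Q j ≤ Q (j + 1)
  B_ge : 100 * ((n : ℝ) + 1) ≤ B
  δ_nonneg : 0 ≤ δ
  δ_le : δ * B ^ 3 ≤ 1 / 2

namespace GoodSample

variable {w : A → I → ℝ} {S : I → I → ℝ} {H : Matrix I I ℂ} {G : Bool → Matrix I I ℂ} {n : ℕ}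
  {B δ r : ℝ} {Q : ℕ → ℝ}

theorem diag_ne (h : GoodSample w S H G n B δ r Q) (i : I) (s : Bool) : G s i i ≠ 0 := by
  intro h0
  have := h.diag_ge s i
  rw [h0, norm_zero] at this
  norm_num at this

theorem norm_inv_sq_le (h : GoodSample w S H G n B δ r Q) (i : I) (s : Bool) :
    ‖(G s i i)⁻¹‖ ^ 2 ≤ 4 := by
  have h1 := h.diag_ge s i
  have h2 : ‖(G s i i)⁻¹‖ ≤ 2 := by
    rw [norm_inv]
    refine inv_le_of_inv_le₀ (by norm_num) (by norm_num; linarith)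
  nlinarith [norm_nonneg (G s i i)⁻¹]

theorem one_le_B (h : GoodSample w S H G n B δ r Q) : 100 ≤ B := by
  have := h.B_ge
  have hn : (0 : ℝ) ≤ n := Nat.cast_nonneg n
  linarith

/-- Concentration of row i trades a mixed row for a variance sum over minors, which `var_le` reduces
to block averages. The factor 4 bounds |G_ii|². Since `mixedChain_row` excludes the column i, the
weight must vanish there. -/
theorem mixed_sum_le (h : GoodSample w S H G n B δ r Q) {i : I} {ω : I → ℝ}
    (hω : ∀ k, 0 ≤ ω k) (hωi : ω i = 0) (s : Bool) (l : List (A × Bool)) (hl : l.length < n)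
    (y : ℝ) (hy : ∀ c, ∑ x, w c x *
      ∑ k, ω k * ‖chain (weightE w) (minor G i) s l x k‖ ^ 2 ≤ y) :
    ∑ k, ω k * ‖mixedChain (weightE w) G (minor G i) s l i k‖ ^ 2 ≤ 4 * B * y := by
  have hB := h.one_le_B
  obtain ⟨ζ, hζ⟩ := h.res
  have h1 : ∀ k, ω k * ‖mixedChain (weightE w) G (minor G i) s l i k‖ ^ 2 ≤
      4 * B * (∑ x, S i x * (ω k * ‖chain (weightE w) (minor G i) s l x k‖ ^ 2)) := by
    intro k
    by_cases hk : k = i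
    · subst hk
      simp [hωi]
    · have h2 : ‖mixedChain (weightE w) G (minor G i) s l i k‖ ^ 2 ≤
          4 * (B * ∑ x, S i x * ‖chain (weightE w) (minor G i) s l x k‖ ^ 2) := by
        unfold weightE
        rw [mixedChain_row (h.diag_ne i) hζ s l hk, norm_neg, norm_mul, mul_pow]
        refine mul_le_mul ?_ (h.lde i k hk s l hl) (by positivity) (by norm_num)
        nlinarith [h.diag_le s i, norm_nonneg (G s i i)]
      calc _ ≤ ω k * (4 * (B * ∑ x, S i x * ‖chain (weightE w) (minor G i) s l x k‖ ^ 2)) :=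
            mul_le_mul_of_nonneg_left h2 (hω k)
        _ = _ := by
          simp only [Finset.mul_sum]
          refine Finset.sum_congr rfl fun x _ => ?_
          ring
  refine (Finset.sum_le_sum fun k _ => h1 k).trans ?_
  rw [← Finset.mul_sum, Finset.sum_comm]
  simp only [← Finset.mul_sum]
  gcongr
  exact h.var_le i _ y (fun x => Finset.sum_nonneg fun k _ => mul_nonneg (hω k) (sq_nonneg _)) hy

theorem minor_sum_le (h : GoodSample w S H G n B δ r Q) (i : I) {ω : I → ℝ}
    (hω : ∀ k, 0 ≤ ω k) (s : Bool) (l : List (A × Bool)) (c : A) :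
    ∑ x, w c x * ∑ k, ω k * ‖chain (weightE w) (minor G i) s l x k‖ ^ 2 ≤
      ((l.length : ℝ) + 2) * (∑ x, w c x * ∑ k, ω k * ‖chain (weightE w) G s l x k‖ ^ 2 +
        ∑ j ∈ Finset.range (l.length + 1), 4 *
          (∑ x, w c x * ‖chain (weightE w) G s (l.take j) x i‖ ^ 2) *
          ∑ k, ω k * ‖mixedChain (weightE w) G (minor G i) (lastSign s (l.take j))
            (l.drop j) i k‖ ^ 2) := by
  have h1 : ∀ x k, ‖chain (weightE w) (minor G i) s l x k‖ ^ 2 ≤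
      ((l.length : ℝ) + 2) * (‖chain (weightE w) G s l x k‖ ^ 2 +
        ∑ j ∈ Finset.range (l.length + 1), 4 *
          ‖chain (weightE w) G s (l.take j) x i‖ ^ 2 *
          ‖mixedChain (weightE w) G (minor G i) (lastSign s (l.take j)) (l.drop j) i k‖ ^ 2) := by
    intro x k
    rw [chain_minor_apply]
    refine (norm_sub_sum_sq_le _ _ _).trans ?_
    push_cast
    rw [add_assoc, one_add_one_eq_two]
    gcongr with j hj
    rw [norm_mul, norm_mul, mul_pow, mul_pow]
    have := h.norm_inv_sq_le i (lastSign s (l.take j))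
    rw [mul_comm 4 (‖chain (weightE w) G s (l.take j) x i‖ ^ 2)]
    gcongr
  calc _ ≤ ∑ x, w c x * ∑ k, ω k * (((l.length : ℝ) + 2) * (‖chain (weightE w) G s l x k‖ ^ 2 +
        ∑ j ∈ Finset.range (l.length + 1), 4 *
          ‖chain (weightE w) G s (l.take j) x i‖ ^ 2 *
          ‖mixedChain (weightE w) G (minor G i) (lastSign s (l.take j)) (l.drop j) i k‖ ^ 2)) := by
        gcongr with x _ k _
        · exact h.w_nonneg c x
        · exact hω k
        · exact h1 x k
    _ = ∑ x, ((l.length : ℝ) + 2) * (w c x * ∑ k, ω k * ‖chain (weightE w) G s l x k‖ ^ 2 +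
        ∑ j ∈ Finset.range (l.length + 1), 4 *
          (w c x * ‖chain (weightE w) G s (l.take j) x i‖ ^ 2) *
          ∑ k, ω k * ‖mixedChain (weightE w) G (minor G i) (lastSign s (l.take j))
            (l.drop j) i k‖ ^ 2) := by
        refine Finset.sum_congr rfl fun x _ => ?_
        simp only [mul_add, Finset.sum_add_distrib, Finset.mul_sum]
        congr 1
        · refine Finset.sum_congr rfl fun k _ => ?_
          ring
        · rw [Finset.sum_comm]
          refine Finset.sum_congr rfl fun j _ => Finset.sum_congr rfl fun k _ => ?_
          ring
    _ = _ := by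
        rw [← Finset.mul_sum, Finset.sum_add_distrib, Finset.sum_comm (s := Finset.univ)]
        congr 2
        refine Finset.sum_congr rfl fun j _ => ?_
        rw [← Finset.sum_mul, ← Finset.mul_sum]

theorem row_sum_le (h : GoodSample w S H G n B δ r Q) (i : I) {ω : I → ℝ}
    (hω : ∀ k, 0 ≤ ω k) (s : Bool) (l : List (A × Bool)) :
    ∑ k, ω k * ‖chain (weightE w) G s l i k‖ ^ 2 ≤
      ((l.length : ℝ) + 1) * ∑ j ∈ Finset.range (l.length + 1), 4 *
          ‖chain (weightE w) G s (l.take j) i i‖ ^ 2 *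
          ∑ k, ω k * ‖mixedChain (weightE w) G (minor G i) (lastSign s (l.take j))
            (l.drop j) i k‖ ^ 2 := by
  have h1 : ∀ k, ‖chain (weightE w) G s l i k‖ ^ 2 ≤
      ((l.length : ℝ) + 1) * ∑ j ∈ Finset.range (l.length + 1), 4 *
          ‖chain (weightE w) G s (l.take j) i i‖ ^ 2 *
          ‖mixedChain (weightE w) G (minor G i) (lastSign s (l.take j)) (l.drop j) i k‖ ^ 2 := by
    intro k
    rw [chain_row_apply (h.diag_ne i)]
    refine (norm_sum_sq_le _ _).trans ?_
    push_cast
    gcongr with j hj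
    rw [norm_mul, norm_mul, mul_pow, mul_pow]
    have := h.norm_inv_sq_le i (lastSign s (l.take j))
    rw [mul_comm 4 (‖chain (weightE w) G s (l.take j) i i‖ ^ 2)]
    gcongr
  refine (Finset.sum_le_sum fun k _ => mul_le_mul_of_nonneg_left (h1 k) (hω k)).trans_eq ?_
  simp only [Finset.mul_sum]
  rw [Finset.sum_comm]
  refine Finset.sum_congr rfl fun j _ => Finset.sum_congr rfl fun k _ => ?_
  ring

theorem Q_anti (h : GoodSample w S H G n B δ r Q) : Antitone Q := antitone_nat_of_succ_le h.Q_succ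

/-- Bounds on the row averages of the chains with `p + 1` resolvents. -/
def RowBound (w : A → I → ℝ) (G : Bool → Matrix I I ℂ) (Q : ℕ → ℝ) (p : ℕ) (K : ℝ) : Prop :=
  ∀ s (l : List (A × Bool)), l.length = p → ∀ i b,
    ∑ k, w b k * ‖chain (weightE w) G s l i k‖ ^ 2 ≤ K * Q (2 * p + 1)

/-- Bounds on the averages of the chains of minors at `i` with `p + 1` resolvents. -/
def MinorBound (w : A → I → ℝ) (G : Bool → Matrix I I ℂ) (Q : ℕ → ℝ) (i : I) (ω : I → ℝ) (p : ℕ)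
    (K : ℝ) : Prop :=
  ∀ s (l : List (A × Bool)), l.length = p → ∀ c,
    ∑ x, w c x * ∑ k, ω k * ‖chain (weightE w) (minor G i) s l x k‖ ^ 2 ≤ K * Q (2 * p + 1)

omit [Fintype I] in
theorem weightE_conjTranspose (w : A → I → ℝ) (a : A) : (weightE w a)ᴴ = weightE w a := by
  unfold weightE
  rw [Matrix.diagonal_conjTranspose]
  congr 1
  ext k
  simp

/-- The adjoint of a chain is a chain of the same length, so column estimates follow from row
estimates, provided these hold for all signs and blocks. -/
theorem col_sum_eq (h : GoodSample w S H G n B δ r Q) (s : Bool) (l : List (A × Bool)) :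
    ∃ s' l', l'.length = l.length ∧ ∀ i x, ‖chain (weightE w) G s l x i‖ =
      ‖chain (weightE w) G s' l' i x‖ := by
  obtain ⟨s', l', hl, he⟩ := exists_chain_conjTranspose (weightE w) G
    (weightE_conjTranspose w) h.adj s l
  refine ⟨s', l', hl, fun i x => ?_⟩
  rw [← he, Matrix.conjTranspose_apply, norm_star]

theorem RowBound.col (h : GoodSample w S H G n B δ r Q) {p : ℕ} {K : ℝ} (hX : RowBound w G Q p K)
    (s : Bool) (l : List (A × Bool)) (hl : l.length = p) (i : I) (c : A) :
    ∑ x, w c x * ‖chain (weightE w) G s l x i‖ ^ 2 ≤ K * Q (2 * p + 1) := by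
  obtain ⟨s', l', hl', he⟩ := h.col_sum_eq s l
  simp only [he]
  exact hX s' l' (hl'.trans hl) i c

/-- Cauchy–Schwarz for the diagonal entries of a product of two chains. -/
theorem diag_sq_le (h : GoodSample w S H G n B δ r Q) (s : Bool) (l : List (A × Bool))
    (p : A × Bool) (l' : List (A × Bool)) (i : I) :
    ‖chain (weightE w) G s (l ++ p :: l') i i‖ ^ 2 ≤
      (∑ k, w p.1 k * ‖chain (weightE w) G s l i k‖ ^ 2) *
        ∑ k, w p.1 k * ‖chain (weightE w) G p.2 l' k i‖ ^ 2 := by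
  have h1 : chain (weightE w) G s (l ++ p :: l') i i = ∑ k, (w p.1 k : ℂ) *
      (chain (weightE w) G s l i k * chain (weightE w) G p.2 l' k i) := by
    rw [chain_append, Matrix.mul_assoc, Matrix.mul_apply]
    refine Finset.sum_congr rfl fun k _ => ?_
    rw [weightE, Matrix.diagonal_mul]
    ring
  have h2 : ‖chain (weightE w) G s (l ++ p :: l') i i‖ ≤ ∑ k,
      (Real.sqrt (w p.1 k) * ‖chain (weightE w) G s l i k‖) *
      (Real.sqrt (w p.1 k) * ‖chain (weightE w) G p.2 l' k i‖) := by
    rw [h1]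
    refine (norm_sum_le _ _).trans (Finset.sum_le_sum fun k _ => ?_)
    have hw := h.w_nonneg p.1 k
    rw [norm_mul, norm_mul, Complex.norm_real, Real.norm_of_nonneg hw]
    apply le_of_eq
    have h3 := Real.mul_self_sqrt hw
    linear_combination (-(‖chain (weightE w) G s l i k‖ * ‖chain (weightE w) G p.2 l' k i‖)) * h3
  calc _ ≤ _ := pow_le_pow_left₀ (norm_nonneg _) h2 2
    _ ≤ _ := Finset.sum_mul_sq_le_sq_mul_sq _ _ _
    _ = _ := by
      simp only [mul_pow, Real.sq_sqrt (h.w_nonneg p.1 _)]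

/-- Cutting after the first resolvent and applying Cauchy–Schwarz uses row averages of strictly
shorter chains only, so this bound is available inside the induction at length p. -/
theorem diag_bound (h : GoodSample w S H G n B δ r Q) {p : ℕ} {K : ℝ} (hK : 1 ≤ K)
    (hX : ∀ q < p, RowBound w G Q q K) (s : Bool) (l : List (A × Bool)) (hl : l.length = p)
    (i : I) : ‖chain (weightE w) G s l i i‖ ^ 2 ≤ 4 * K ^ 2 * Q (2 * p) := by
  cases l with
  | nil =>
    simp only [List.length_nil] at hl
    subst hl
    simp only [chain]
    have h1 := h.diag_le s i
    have h2 := h.Q_zero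
    have h3 : ‖G s i i‖ ^ 2 ≤ 4 := by nlinarith [norm_nonneg (G s i i)]
    have h4 : 1 ≤ K ^ 2 := one_le_pow₀ hK
    rw [mul_zero]
    nlinarith
  | cons a l =>
    simp only [List.length_cons] at hl
    subst hl
    have h1 := h.diag_sq_le s [] a l i
    rw [List.nil_append] at h1
    refine h1.trans ?_
    have h2 := hX 0 (by omega) s [] rfl i a.1
    have h3 := RowBound.col h (hX l.length (by omega)) a.2 l rfl i a.1
    have h4 := h.Q_mul (2 * 0 + 1) (2 * l.length + 1)
    have hQ := h.Q_nonneg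
    calc _ ≤ (K * Q (2 * 0 + 1)) * (K * Q (2 * l.length + 1)) := by
          refine mul_le_mul h2 h3 ?_ (by have := hQ (2 * 0 + 1); positivity)
          exact Finset.sum_nonneg fun k _ => mul_nonneg (h.w_nonneg _ _) (sq_nonneg _)
      _ = K ^ 2 * (Q (2 * 0 + 1) * Q (2 * l.length + 1)) := by ring
      _ ≤ K ^ 2 * (3 * Q (2 * 0 + 1 + (2 * l.length + 1))) := by gcongr
      _ ≤ K ^ 2 * (4 * Q (2 * 0 + 1 + (2 * l.length + 1))) := by
          have := hQ (2 * 0 + 1 + (2 * l.length + 1))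
          gcongr
          norm_num
      _ = _ := by
          rw [show 2 * 0 + 1 + (2 * l.length + 1) = 2 * (l.length + 1) by ring]
          ring

end GoodSample

end Deterministic

/-! ### Closing the recursion for row averages, minors and entries -/

section Deterministic

variable {I A : Type*} [Fintype I] [DecidableEq I]

namespace GoodSample

variable {w : A → I → ℝ} {S : I → I → ℝ} {H : Matrix I I ℂ} {G : Bool → Matrix I I ℂ} {n : ℕ}
  {B δ r : ℝ} {Q : ℕ → ℝ}

theorem col_le (h : GoodSample w S H G n B δ r Q) (s : Bool) (i : I) (c : A) :
    ∑ x, w c x * ‖G s x i‖ ^ 2 ≤ δ := by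
  have h1 : ∀ x, ‖G s x i‖ = ‖G (!s) i x‖ := fun x => by
    rw [← h.adj, Matrix.conjTranspose_apply, norm_star]
  simp only [h1]
  exact h.avg_le _ i c

omit [Fintype I] [DecidableEq I] in
theorem sum_range_le_of_cases {p : ℕ} {F : ℕ → ℝ} {a b c : ℝ} (hb : 0 ≤ b)
    (hc : 0 ≤ c) (h0 : F 0 ≤ a) (hp : 1 ≤ p → F p ≤ b) (h : ∀ j, 1 ≤ j → j < p → F j ≤ c) :
    ∑ j ∈ Finset.range (p + 1), F j ≤ a + b + p * c := by
  have h1 : ∀ j ∈ Finset.range (p + 1), F j ≤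
      (if j = 0 then a else c) + if j = p then b else 0 := by
    intro j hj
    rw [Finset.mem_range] at hj
    rcases Nat.eq_zero_or_pos j with h2 | h2
    · subst h2
      rw [if_pos rfl]
      split_ifs <;> linarith
    · rw [if_neg (by omega)]
      by_cases h3 : j = p
      · subst h3
        rw [if_pos rfl]
        linarith [hp h2]
      · rw [if_neg h3]
        linarith [h j h2 (by omega)]
  refine (Finset.sum_le_sum h1).trans (le_of_eq ?_)
  rw [Finset.sum_add_distrib, Finset.sum_range_succ']
  simp
  ring

/-- In the expansion of a chain of minors, full-length quantities occur only at the two ends of the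
sum, and there with a factor δ. At j = 0 the prefix is a single G with small column average,
multiplying a mixed chain bounded through y. At j = p the suffix is a single G with small row
average, multiplying the column average X. The middle terms are products of shorter chains and
combine by `Q_mul`. -/
theorem minor_step (h : GoodSample w S H G n B δ r Q) {i : I} {ω : I → ℝ}
    (hω : ∀ k, 0 ≤ ω k) (hωi : ω i = 0) (hωG : ∀ s, ∑ k, ω k * ‖G s i k‖ ^ 2 ≤ δ)
    {p : ℕ} (hp : p < n) {K T X y : ℝ} (hK : 0 ≤ K) (hX : ∀ q < p, RowBound w G Q q K)
    (hU : ∀ q < p, MinorBound w G Q i ω q K) (s : Bool) (l : List (A × Bool)) (hl : l.length = p)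
    (hT : ∀ c, ∑ x, w c x * ∑ k, ω k * ‖chain (weightE w) G s l x k‖ ^ 2 ≤ T)
    (hXp : ∀ c, ∑ x, w c x * ‖chain (weightE w) G s l x i‖ ^ 2 ≤ X)
    (hy : ∀ c, ∑ x, w c x * ∑ k, ω k * ‖chain (weightE w) (minor G i) s l x k‖ ^ 2 ≤ y)
    (c : A) :
    ∑ x, w c x * ∑ k, ω k * ‖chain (weightE w) (minor G i) s l x k‖ ^ 2 ≤
      ((p : ℝ) + 2) * (T + (16 * B * δ * y + 4 * X * δ + p * (48 * B * K ^ 2 * Q (2 * p + 1)))) := by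
  have hB := h.one_le_B
  have hδ := h.δ_nonneg
  have hQ := h.Q_nonneg
  have hw := h.w_nonneg
  have hy0 : 0 ≤ y := le_trans (Finset.sum_nonneg fun x _ => mul_nonneg (hw _ _)
    (Finset.sum_nonneg fun k _ => mul_nonneg (hω k) (sq_nonneg _))) (hy c)
  have hX0 : 0 ≤ X := le_trans (Finset.sum_nonneg fun x _ => mul_nonneg (hw _ _)
    (sq_nonneg _)) (hXp c)
  subst hl
  refine (h.minor_sum_le i hω s l c).trans ?_
  refine mul_le_mul_of_nonneg_left (add_le_add (hT c) ?_) (by positivity)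
  refine sum_range_le_of_cases (by positivity)
    (by have := hQ (2 * l.length + 1); positivity) ?_ ?_ ?_
  · have h1 := h.mixed_sum_le hω hωi s l hp y hy
    have h2 := h.col_le s i c
    simp only [List.take_zero, List.drop_zero, lastSign, chain]
    calc _ ≤ 4 * δ * (4 * B * y) := by
          refine mul_le_mul (by linarith) h1 ?_ (by positivity)
          exact Finset.sum_nonneg fun k _ => mul_nonneg (hω k) (sq_nonneg _)
      _ = _ := by ring
  · intro _
    rw [List.take_length, List.drop_length]
    simp only [mixedChain]
    refine mul_le_mul (by linarith [hXp c]) (hωG _) ?_ (by positivity)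
    exact Finset.sum_nonneg fun k _ => mul_nonneg (hω k) (sq_nonneg _)
  · intro j hj1 hj2
    have h1 := RowBound.col h (hX j hj2) s (l.take j) (by simp; omega) i c
    have h2 := h.mixed_sum_le hω hωi (lastSign s (l.take j)) (l.drop j) (by simp; omega) _
      (hU (l.length - j) (by omega) _ (l.drop j) (by simp))
    have h3 := h.Q_mul (2 * j + 1) (2 * (l.length - j) + 1)
    have h4 : Q (2 * j + 1 + (2 * (l.length - j) + 1)) ≤ Q (2 * l.length + 1) :=
      h.Q_anti (by omega)
    calc _ ≤ 4 * (K * Q (2 * j + 1)) * (4 * B * (K * Q (2 * (l.length - j) + 1))) := by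
          refine mul_le_mul (by linarith) h2 ?_ (by have := hQ (2 * j + 1); positivity)
          exact Finset.sum_nonneg fun k _ => mul_nonneg (hω k) (sq_nonneg _)
      _ = 16 * B * K ^ 2 * (Q (2 * j + 1) * Q (2 * (l.length - j) + 1)) := by ring
      _ ≤ 16 * B * K ^ 2 * (3 * Q (2 * l.length + 1)) := by
          have h5 : Q (2 * j + 1) * Q (2 * (l.length - j) + 1) ≤ 3 * Q (2 * l.length + 1) := by
            linarith
          gcongr
      _ = _ := by ring

/-- The term j = 0 of the row expansion contains the full-length chain of minors, with no small
factor, and produces the y-term. In every other term the chain of minors is shorter and the prefix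
is controlled by `diag_bound`. -/
theorem row_step (h : GoodSample w S H G n B δ r Q) {i : I} {ω : I → ℝ}
    (hω : ∀ k, 0 ≤ ω k) (hωi : ω i = 0)
    {p : ℕ} (hp : p < n) {K y : ℝ} (hK : 1 ≤ K) (hX : ∀ q < p, RowBound w G Q q K)
    (hU : ∀ q < p, MinorBound w G Q i ω q K) (s : Bool) (l : List (A × Bool)) (hl : l.length = p)
    (hy : ∀ c, ∑ x, w c x * ∑ k, ω k * ‖chain (weightE w) (minor G i) s l x k‖ ^ 2 ≤ y) :
    ∑ k, ω k * ‖chain (weightE w) G s l i k‖ ^ 2 ≤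
      ((p : ℝ) + 1) * (64 * B * y + (p + 1) * (192 * B * K ^ 3 * Q (2 * p + 1))) := by
  have hB := h.one_le_B
  have hQ := h.Q_nonneg
  subst hl
  have hQl := hQ (2 * l.length + 1)
  refine (h.row_sum_le i hω s l).trans ?_
  refine mul_le_mul_of_nonneg_left ?_ (by positivity)
  have key : ∀ j, 1 ≤ j → j ≤ l.length →
      4 * ‖chain (weightE w) G s (l.take j) i i‖ ^ 2 *
          ∑ k, ω k * ‖mixedChain (weightE w) G (minor G i) (lastSign s (l.take j))
            (l.drop j) i k‖ ^ 2 ≤ 192 * B * K ^ 3 * Q (2 * l.length + 1) := by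
    intro j hj1 hj2
    have h1 := h.diag_bound hK (p := j) (fun q hq => hX q (by omega)) s (l.take j)
      (by simp; omega) i
    have h2 := h.mixed_sum_le hω hωi (lastSign s (l.take j)) (l.drop j) (by simp; omega) _
      (hU (l.length - j) (by omega) _ (l.drop j) (by simp))
    have h3 := h.Q_mul (2 * j) (2 * (l.length - j) + 1)
    rw [show 2 * j + (2 * (l.length - j) + 1) = 2 * l.length + 1 by omega] at h3
    calc _ ≤ 4 * (4 * K ^ 2 * Q (2 * j)) * (4 * B * (K * Q (2 * (l.length - j) + 1))) := by
          refine mul_le_mul (by linarith) h2 ?_ (by have := hQ (2 * j); positivity)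
          exact Finset.sum_nonneg fun k _ => mul_nonneg (hω k) (sq_nonneg _)
      _ = 64 * B * K ^ 3 * (Q (2 * j) * Q (2 * (l.length - j) + 1)) := by ring
      _ ≤ 64 * B * K ^ 3 * (3 * Q (2 * l.length + 1)) := by gcongr
      _ = _ := by ring
  refine (sum_range_le_of_cases (a := 64 * B * y)
    (b := 192 * B * K ^ 3 * Q (2 * l.length + 1)) (by positivity)
    (c := 192 * B * K ^ 3 * Q (2 * l.length + 1)) (by positivity) ?_ ?_ ?_).trans (le_of_eq ?_)
  · have h1 := h.mixed_sum_le hω hωi s l hp y hy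
    simp only [List.take_zero, List.drop_zero, lastSign, chain]
    have h2 : ‖G s i i‖ ^ 2 ≤ 4 := by nlinarith [h.diag_le s i, norm_nonneg (G s i i)]
    calc _ ≤ 4 * 4 * (4 * B * y) := by
          refine mul_le_mul (by linarith) h1 ?_ (by positivity)
          exact Finset.sum_nonneg fun k _ => mul_nonneg (hω k) (sq_nonneg _)
      _ = _ := by ring
  · exact fun h1 => key _ h1 le_rfl
  · exact fun j h1 h2 => key j h1 h2.le
  · ring

theorem RowBound.mono (h : GoodSample w S H G n B δ r Q) {p : ℕ} {K K' : ℝ} (hK : K ≤ K')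
    (hX : RowBound w G Q p K) : RowBound w G Q p K' := fun s l hl i b =>
  (hX s l hl i b).trans (mul_le_mul_of_nonneg_right hK (h.Q_nonneg _))

theorem MinorBound.mono (h : GoodSample w S H G n B δ r Q) {i : I} {ω : I → ℝ} {p : ℕ}
    {K K' : ℝ} (hK : K ≤ K') (hX : MinorBound w G Q i ω p K) : MinorBound w G Q i ω p K' :=
  fun s l hl c => (hX s l hl c).trans (mul_le_mul_of_nonneg_right hK (h.Q_nonneg _))

/-- The weight `w b` with the entry `i` removed. -/
def offWeight (w : A → I → ℝ) (b : A) (i k : I) : ℝ := if k = i then 0 else w b k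

theorem offWeight_nonneg (h : GoodSample w S H G n B δ r Q) (b : A) (i k : I) :
    0 ≤ offWeight w b i k := by
  unfold offWeight
  split_ifs
  exacts [le_rfl, h.w_nonneg b k]

theorem offWeight_le (h : GoodSample w S H G n B δ r Q) (b : A) (i k : I) :
    offWeight w b i k ≤ w b k := by
  unfold offWeight
  split_ifs
  exacts [h.w_nonneg b k, le_rfl]

/-- The total coefficient of y is at most a multiple of δ B³ ≤ 1/2, small enough to be absorbed. The
powers of B also swallow the combinatorial factor p + 2 ≤ B / 100. -/
theorem minor_self_bound (h : GoodSample w S H G n B δ r Q) {p : ℕ} (hp : p < n) {T X y q K R : ℝ}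
    (hq : 0 ≤ q) (hKB : B ≤ K) (hT : T ≤ K ^ 2 * q) (hX : X ≤ B ^ 2 * y + B ^ 3 * K ^ 3 * q)
    (hy : 0 ≤ y)
    (hR : R ≤ ((p : ℝ) + 2) * (T + (16 * B * δ * y + 4 * X * δ + p * (48 * B * K ^ 2 * q)))) :
    R ≤ B ^ 3 * K ^ 3 * q / 2 + y / 2 := by
  have hB := h.one_le_B
  have hδ := h.δ_nonneg
  have hp' : (p : ℝ) + 1 ≤ n := by exact_mod_cast hp
  have hpB : (p : ℝ) + 2 ≤ B / 100 := by linarith [h.B_ge]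
  have hp0 : (0 : ℝ) ≤ p := Nat.cast_nonneg p
  have hδB := h.δ_le
  have hK0 : 0 ≤ K := by linarith
  have e1 : 4 * X * δ ≤ 4 * (B ^ 2 * y + B ^ 3 * K ^ 3 * q) * δ := by gcongr
  have e2 : 4 * (B ^ 2 * y + B ^ 3 * K ^ 3 * q) * δ =
      4 * B ^ 2 * δ * y + 4 * (δ * B ^ 3) * (K ^ 3 * q) := by ring
  have e3 : 4 * (δ * B ^ 3) * (K ^ 3 * q) ≤ 2 * (K ^ 3 * q) := by
    have : 0 ≤ K ^ 3 * q := by positivity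
    nlinarith
  have e4 : (p : ℝ) * (48 * B * K ^ 2 * q) ≤ B * (B * K ^ 2 * q) := by
    have : 0 ≤ B * K ^ 2 * q := by positivity
    nlinarith
  have e5 : 16 * B * δ * y ≤ B ^ 2 * δ * y := by
    have : 0 ≤ δ * y := by positivity
    have h16 : 16 * B ≤ B ^ 2 := by nlinarith
    nlinarith
  have e6 : T + (16 * B * δ * y + 4 * X * δ + p * (48 * B * K ^ 2 * q)) ≤
      5 * B ^ 2 * δ * y + (K ^ 2 * q + 2 * (K ^ 3 * q) + B * (B * K ^ 2 * q)) := by linarith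
  have e7 : K ^ 2 * q + 2 * (K ^ 3 * q) + B * (B * K ^ 2 * q) ≤ 4 * (B * K ^ 3 * q) := by
    have a1 : K ^ 2 * q ≤ B * K ^ 3 * q := by
      have : (1 : ℝ) ≤ B * K := by nlinarith
      have h2 : 0 ≤ K ^ 2 * q := by positivity
      nlinarith
    have a2 : K ^ 3 * q ≤ B * K ^ 3 * q / 2 := by
      have h2 : 0 ≤ K ^ 3 * q := by positivity
      nlinarith
    have a3 : B * (B * K ^ 2 * q) ≤ B * K ^ 3 * q := by
      have h2 : 0 ≤ B * K ^ 2 * q := by positivity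
      nlinarith
    have a4 : 0 ≤ B * K ^ 3 * q := by positivity
    linarith
  have e8 : R ≤ (B / 100) * (5 * B ^ 2 * δ * y + 4 * (B * K ^ 3 * q)) := by
    refine hR.trans ?_
    refine (mul_le_mul_of_nonneg_left (e6.trans (add_le_add_right e7 _)) (by positivity)).trans ?_
    exact mul_le_mul_of_nonneg_right hpB (by positivity)
  have e9 : (B / 100) * (5 * B ^ 2 * δ * y) ≤ y / 2 := by
    have : (B / 100) * (5 * B ^ 2 * δ * y) = (δ * B ^ 3) * y / 20 := by ring
    rw [this]
    nlinarith
  have e10 : (B / 100) * (4 * (B * K ^ 3 * q)) ≤ B ^ 3 * K ^ 3 * q / 2 := by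
    have : 0 ≤ B ^ 2 * (K ^ 3 * q) := by positivity
    nlinarith
  linarith

theorem row_self_bound (h : GoodSample w S H G n B δ r Q) {p : ℕ} (hp : p < n) {y q K R : ℝ}
    (hq : 0 ≤ q) (hKB : B ≤ K) (hy : 0 ≤ y)
    (hR : R ≤ ((p : ℝ) + 1) * (64 * B * y + (p + 1) * (192 * B * K ^ 3 * q)) + 4 * K ^ 2 * q) :
    R ≤ B ^ 2 * y + B ^ 3 * K ^ 3 * q := by
  have hB := h.one_le_B
  have hp' : (p : ℝ) + 1 ≤ n := by exact_mod_cast hp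
  have hpB : (p : ℝ) + 1 ≤ B / 100 := by linarith [h.B_ge]
  have hp0 : (0 : ℝ) ≤ p := Nat.cast_nonneg p
  have hK0 : 0 ≤ K := by linarith
  have e1 : ((p : ℝ) + 1) * (64 * B * y + (p + 1) * (192 * B * K ^ 3 * q)) ≤
      (B / 100) * (64 * B * y + (B / 100) * (192 * B * K ^ 3 * q)) := by gcongr
  have e2 : 0 ≤ B ^ 2 * y := by positivity
  have e3 : 4 * K ^ 2 * q ≤ B ^ 3 * K ^ 3 * q / 2 := by
    have h1 : 0 ≤ K ^ 2 * q := by positivity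
    have h2 : 8 ≤ B ^ 3 * K := by
      have : (100 : ℝ) ^ 3 ≤ B ^ 3 := by gcongr
      nlinarith
    nlinarith
  have e4 : 0 ≤ B ^ 3 * K ^ 3 * q := by positivity
  have e5 : (B / 100) * (64 * B * y + (B / 100) * (192 * B * K ^ 3 * q)) =
    (64 / 100) * (B ^ 2 * y) + (192 / 10000) * (B ^ 3 * K ^ 3 * q) := by ring
  linarith

/-- The induction step in the length of the chains. -/
theorem row_minor_step [Finite A] (h : GoodSample w S H G n B δ r Q) {p : ℕ} (hp : p < n) {K : ℝ}
    (hKB : B ≤ K) (hX : ∀ q < p, RowBound w G Q q K)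
    (hU : ∀ q < p, ∀ i b, MinorBound w G Q i (offWeight w b i) q K) :
    RowBound w G Q p (K ^ 9) ∧ ∀ i b, MinorBound w G Q i (offWeight w b i) p (K ^ 9) := by
  have hB := h.one_le_B
  have hQ := h.Q_nonneg
  have hQp := hQ (2 * p + 1)
  have hK1 : 1 ≤ K := by linarith
  have hrow : ∀ y, 0 ≤ y → (∀ i b s (l : List (A × Bool)), l.length = p → ∀ c,
      ∑ x, w c x * ∑ k, offWeight w b i k * ‖chain (weightE w) (minor G i) s l x k‖ ^ 2 ≤ y) →
      ∀ s (l : List (A × Bool)), l.length = p → ∀ i b,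
        ∑ k, w b k * ‖chain (weightE w) G s l i k‖ ^ 2 ≤
          B ^ 2 * y + B ^ 3 * K ^ 3 * Q (2 * p + 1) := by
    intro y hy0 hy s l hl i b
    have h1 := h.row_step (h.offWeight_nonneg b i) (by simp [offWeight]) hp hK1 hX
      (fun q hq => hU q hq i b) s l hl (hy i b s l hl)
    refine h.row_self_bound hp hQp hKB hy0 ?_
    -- The term k = i, excluded from the concentration estimate, has weight at most r and is covered
    -- by `diag_bound` and `Q_r`.
    have h2 : ∑ k, w b k * ‖chain (weightE w) G s l i k‖ ^ 2 =
        ∑ k, offWeight w b i k * ‖chain (weightE w) G s l i k‖ ^ 2 +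
          w b i * ‖chain (weightE w) G s l i i‖ ^ 2 := by
      have h3 : w b i * ‖chain (weightE w) G s l i i‖ ^ 2 =
          ∑ k, if k = i then w b k * ‖chain (weightE w) G s l i k‖ ^ 2 else 0 := by simp
      rw [h3, ← Finset.sum_add_distrib]
      refine Finset.sum_congr rfl fun k _ => ?_
      unfold offWeight
      split_ifs <;> simp
    rw [h2]
    refine add_le_add h1 ?_
    have h3 := h.diag_bound hK1 hX s l hl i
    have h4 := h.Q_r (2 * p)
    calc _ ≤ r * (4 * K ^ 2 * Q (2 * p)) := by
          refine mul_le_mul (h.w_le b i) h3 (sq_nonneg _) ?_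
          exact (h.w_nonneg b i).trans (h.w_le b i)
      _ = 4 * K ^ 2 * (r * Q (2 * p)) := by ring
      _ ≤ _ := by gcongr
  have hminor : ∀ i b s (l : List (A × Bool)), l.length = p → ∀ c,
      ∑ x, w c x * ∑ k, offWeight w b i k * ‖chain (weightE w) (minor G i) s l x k‖ ^ 2 ≤
        B ^ 3 * K ^ 3 * Q (2 * p + 1) := by
    -- The maximum runs over all i, blocks, signs and chains at once: estimating a column passes to
    -- the adjoint chain, whose row bound in turn uses other minors of length p.
    let F : I × A × Bool × List.Vector (A × Bool) p × A → ℝ := fun t =>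
      ∑ x, w t.2.2.2.2 x * ∑ k, offWeight w t.2.1 t.1 k *
        ‖chain (weightE w) (minor G t.1) t.2.2.1 t.2.2.2.1.1 x k‖ ^ 2
    have : Fintype A := Fintype.ofFinite A
    have hF := le_two_mul_of_self_bound F (B ^ 3 * K ^ 3 * Q (2 * p + 1) / 2) ?_
    · intro i b s l hl c
      have := hF (i, b, s, ⟨l, hl⟩, c)
      simp only [F] at this
      linarith
    · rintro y hy ⟨i, b, s, ⟨l, hl⟩, c⟩
      have hy' : ∀ i b s (l : List (A × Bool)), l.length = p → ∀ c,
        ∑ x, w c x * ∑ k, offWeight w b i k * ‖chain (weightE w) (minor G i) s l x k‖ ^ 2 ≤ y :=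
        fun i b s l hl c => hy (i, b, s, ⟨l, hl⟩, c)
      have hy0 : 0 ≤ y := le_trans (Finset.sum_nonneg fun x _ => mul_nonneg (h.w_nonneg _ _)
        (Finset.sum_nonneg fun k _ => mul_nonneg (h.offWeight_nonneg b i k) (sq_nonneg _)))
        (hy' i b s l hl c)
      have h1 := h.minor_step (h.offWeight_nonneg b i) (by simp [offWeight])
        (fun s => (Finset.sum_le_sum fun k _ => mul_le_mul_of_nonneg_right
          (h.offWeight_le b i k) (sq_nonneg _)).trans (h.avg_le s i b)) hp (by linarith) hX
        (fun q hq => hU q hq i b) s l hl (T := B * Q (2 * p + 1))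
        (X := B ^ 2 * y + B ^ 3 * K ^ 3 * Q (2 * p + 1)) ?_ ?_ (hy' i b s l hl) c
      · exact h.minor_self_bound hp hQp hKB
          (mul_le_mul_of_nonneg_right (by nlinarith) hQp) le_rfl hy0 h1
      · intro c
        rw [← hl]
        refine le_trans ?_ (h.loop s l (by omega) c b)
        gcongr with x _ k _
        · exact h.w_nonneg c x
        · exact h.offWeight_le b i k
      · intro c
        obtain ⟨s', l', hl', he⟩ := h.col_sum_eq s l
        simp only [he]
        exact hrow y hy0 hy' s' l' (hl'.trans hl) i c
  have hK3 : B ^ 3 * K ^ 3 ≤ K ^ 6 := by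
    calc B ^ 3 * K ^ 3 ≤ K ^ 3 * K ^ 3 := by gcongr
      _ = K ^ 6 := by ring
  have hK6 : K ^ 6 ≤ K ^ 9 := pow_le_pow_right₀ hK1 (by norm_num)
  refine ⟨fun s l hl i b => ?_, fun i b s l hl c => ?_⟩
  · refine (hrow _ (by positivity) hminor s l hl i b).trans ?_
    have h1 : B ^ 2 * (B ^ 3 * K ^ 3 * Q (2 * p + 1)) ≤ K ^ 8 * Q (2 * p + 1) := by
      calc _ = B ^ 2 * (B ^ 3 * K ^ 3) * Q (2 * p + 1) := by ring
        _ ≤ K ^ 2 * K ^ 6 * Q (2 * p + 1) := by gcongr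
        _ = _ := by ring
    have h2 : B ^ 3 * K ^ 3 * Q (2 * p + 1) ≤ K ^ 8 * Q (2 * p + 1) := by
      refine mul_le_mul_of_nonneg_right (hK3.trans ?_) hQp
      exact pow_le_pow_right₀ hK1 (by norm_num)
    have h3 : K ^ 8 * 2 ≤ K ^ 9 := by
      rw [pow_succ K 8]
      gcongr
      linarith
    nlinarith
  · exact (hminor i b s l hl c).trans (mul_le_mul_of_nonneg_right (hK3.trans hK6) hQp)

/-- Each of the m induction steps replaces the constant K by K^9, whence the tower 9^m in the
exponent. -/
theorem row_minor_bound [Finite A] (h : GoodSample w S H G n B δ r Q) (m : ℕ) (hm : m ≤ n) :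
    ∀ p < m, RowBound w G Q p (B ^ 9 ^ m) ∧
      ∀ i b, MinorBound w G Q i (offWeight w b i) p (B ^ 9 ^ m) := by
  have hB1 : 1 ≤ B := by linarith [h.one_le_B]
  induction m with
  | zero => intro p hp; omega
  | succ m ih =>
    intro p hp
    have ih := ih (by omega)
    have hle : B ^ 9 ^ m ≤ B ^ 9 ^ (m + 1) :=
      pow_le_pow_right₀ hB1 (Nat.pow_le_pow_right (by norm_num) (by omega))
    rcases Nat.lt_succ_iff_lt_or_eq.1 hp with h1 | h1
    · exact ⟨(ih p h1).1.mono h hle, fun i b => ((ih p h1).2 i b).mono h hle⟩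
    · subst h1
      have := h.row_minor_step (p := p) (by omega) (K := B ^ 9 ^ p)
        (le_self_pow₀ hB1 (by positivity)) (fun q hq => (ih q hq).1) (fun q hq => (ih q hq).2)
      rwa [← pow_mul, ← pow_succ] at this

/-- The induction step for the entries of the chains of minors. -/
theorem entry_step [Finite A] (h : GoodSample w S H G n B δ r Q) {p : ℕ} (hp : p < n) {K : ℝ}
    (hKB : B ≤ K) (hX : ∀ q < n, RowBound w G Q q K) {i j : I} (hij : i ≠ j)
    (hU : ∀ q < p, MinorBound w G Q i (Pi.single j 1) q K) :
    MinorBound w G Q i (Pi.single j 1) p (K ^ 9) ∧ ∀ s (l : List (A × Bool)), l.length = p →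
      ‖chain (weightE w) G s l i j‖ ^ 2 ≤ K ^ 9 * Q (2 * p + 1) := by
  have hB := h.one_le_B
  have hQp := h.Q_nonneg (2 * p + 1)
  have hK1 : 1 ≤ K := by linarith
  have hω : ∀ k, 0 ≤ (Pi.single j 1 : I → ℝ) k := by
    intro k
    by_cases hk : k = j
    · subst hk; simp
    · simp [hk]
  have hωi : (Pi.single j 1 : I → ℝ) i = 0 := by simp [hij]
  have hsum : ∀ f : I → ℝ, ∑ k, (Pi.single j 1 : I → ℝ) k * f k = f j := by
    intro f
    rw [Finset.sum_eq_single j] <;> simp +contextual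
  have hK3 : B ^ 3 * K ^ 3 ≤ K ^ 6 := by
    calc B ^ 3 * K ^ 3 ≤ K ^ 3 * K ^ 3 := by gcongr
      _ = K ^ 6 := by ring
  have hminor : ∀ s (l : List (A × Bool)), l.length = p → ∀ c, ∑ x, w c x *
      ∑ k, (Pi.single j 1 : I → ℝ) k * ‖chain (weightE w) (minor G i) s l x k‖ ^ 2 ≤
        B ^ 3 * K ^ 3 * Q (2 * p + 1) := by
    intro s l hl c
    have hF := le_two_mul_of_self_bound (fun c => ∑ x, w c x *
      ∑ k, (Pi.single j 1 : I → ℝ) k * ‖chain (weightE w) (minor G i) s l x k‖ ^ 2)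
      (B ^ 3 * K ^ 3 * Q (2 * p + 1) / 2) ?_ c
    · linarith
    · intro y hy c
      have hy0 : 0 ≤ y := le_trans (Finset.sum_nonneg fun x _ => mul_nonneg (h.w_nonneg _ _)
        (Finset.sum_nonneg fun k _ => mul_nonneg (hω k) (sq_nonneg _))) (hy c)
      -- The row averages of all lengths below n are already known, so T and X are the column
      -- averages at j and at i. The y-term then comes only from the same chain, and a maximum over
      -- c suffices.
      have h1 := h.minor_step hω hωi
        (fun s => by rw [hsum]; exact h.off_le s i j hij) hp (by linarith)
        (fun q hq => hX q (by omega)) hU s l hl (T := K * Q (2 * p + 1))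
        (X := K * Q (2 * p + 1)) ?_ ?_ hy c
      · refine h.minor_self_bound hp hQp hKB (mul_le_mul_of_nonneg_right (by nlinarith) hQp)
          ?_ hy0 h1
        have h2 : K * Q (2 * p + 1) ≤ B ^ 3 * K ^ 3 * Q (2 * p + 1) := by
          refine mul_le_mul_of_nonneg_right ?_ hQp
          have h3 : 1 ≤ B ^ 3 := one_le_pow₀ (by linarith)
          have h4 : K ≤ K ^ 3 := le_self_pow₀ hK1 (by norm_num)
          nlinarith
        have : 0 ≤ B ^ 2 * y := by positivity
        linarith
      · intro c
        simp only [hsum]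
        exact (hX p hp).col h s l hl j c
      · intro c
        exact (hX p hp).col h s l hl i c
  refine ⟨fun s l hl c => (hminor s l hl c).trans ?_, fun s l hl => ?_⟩
  · exact mul_le_mul_of_nonneg_right
      (hK3.trans (pow_le_pow_right₀ hK1 (by norm_num))) hQp
  · have h1 := h.row_step hω hωi hp hK1 (fun q hq => hX q (by omega)) hU s l hl
      (hminor s l hl)
    rw [hsum] at h1
    have h2 := h.row_self_bound hp hQp hKB (by positivity)
      (h1.trans (le_add_of_nonneg_right (by positivity : 0 ≤ 4 * K ^ 2 * Q (2 * p + 1))))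
    refine h2.trans ?_
    have h1 : B ^ 2 * (B ^ 3 * K ^ 3 * Q (2 * p + 1)) ≤ K ^ 8 * Q (2 * p + 1) := by
      calc _ = B ^ 2 * (B ^ 3 * K ^ 3) * Q (2 * p + 1) := by ring
        _ ≤ K ^ 2 * K ^ 6 * Q (2 * p + 1) := by gcongr
        _ = _ := by ring
    have h2 : B ^ 3 * K ^ 3 * Q (2 * p + 1) ≤ K ^ 8 * Q (2 * p + 1) := by
      refine mul_le_mul_of_nonneg_right (hK3.trans ?_) hQp
      exact pow_le_pow_right₀ hK1 (by norm_num)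
    have h3 : K ^ 8 * 2 ≤ K ^ 9 := by
      rw [pow_succ K 8]
      gcongr
      linarith
    nlinarith

theorem entry_bound [Finite A] (h : GoodSample w S H G n B δ r Q) {i j : I} (hij : i ≠ j)
    {m : ℕ} (hm : m ≤ n) : ∀ p < m, MinorBound w G Q i (Pi.single j 1) p (B ^ 9 ^ (n + m)) ∧
      ∀ s (l : List (A × Bool)), l.length = p →
        ‖chain (weightE w) G s l i j‖ ^ 2 ≤ B ^ 9 ^ (n + m) * Q (2 * p + 1) := by
  have hB1 : 1 ≤ B := by linarith [h.one_le_B]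
  induction m with
  | zero => intro p hp; omega
  | succ m ih =>
    intro p hp
    have ih := ih (by omega)
    have hle : ∀ a b : ℕ, a ≤ b → B ^ 9 ^ a ≤ B ^ 9 ^ b := fun a b hab =>
      pow_le_pow_right₀ hB1 (Nat.pow_le_pow_right (by norm_num) hab)
    rcases Nat.lt_succ_iff_lt_or_eq.1 hp with h1 | h1
    · refine ⟨(ih p h1).1.mono h (hle _ _ (by omega)), fun s l hl => ?_⟩
      exact ((ih p h1).2 s l hl).trans
        (mul_le_mul_of_nonneg_right (hle _ _ (by omega)) (h.Q_nonneg _))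
    · subst h1
      -- The exponent starts at n because the constant must also dominate that of the row averages,
      -- B ^ 9 ^ n.
      have := h.entry_step (p := p) (by omega) (K := B ^ 9 ^ (n + p))
        (le_self_pow₀ hB1 (by positivity))
        (fun q hq => ((h.row_minor_bound n le_rfl q hq).1).mono h (hle _ _ (by omega))) hij
        (fun q hq => (ih q hq).1)
      rwa [← pow_mul, ← pow_succ] at this

/-- The off-diagonal entries of the chains with `p + 1 ≤ n` resolvents. -/
theorem off_diag_bound [Finite A] (h : GoodSample w S H G n B δ r Q) {i j : I} (hij : i ≠ j)
    (s : Bool) (l : List (A × Bool)) (hl : l.length < n) :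
    ‖chain (weightE w) G s l i j‖ ^ 2 ≤ B ^ 9 ^ (n + n) * Q (2 * l.length + 1) :=
  (h.entry_bound hij le_rfl l.length hl).2 s l rfl

/-- The diagonal entries of the chains with `2 (p + 1) ≤ 2 n` resolvents. -/
theorem diag_even_bound [Finite A] (h : GoodSample w S H G n B δ r Q) {p : ℕ} (hp : p < n)
    (s : Bool) (l : List (A × Bool)) (hl : l.length = 2 * p + 1) (i : I) :
    ‖chain (weightE w) G s l i i‖ ≤ B ^ 9 ^ n * Q (2 * p + 1) := by
  have hB1 : 1 ≤ B := by linarith [h.one_le_B]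
  -- The 2p + 2 resolvents split into two chains of p + 1 each around the middle block projection.
  obtain ⟨l₁, a, l₂, rfl, h₁, h₂⟩ : ∃ l₁ a l₂, l = l₁ ++ a :: l₂ ∧ l₁.length = p ∧
      l₂.length = p := by
    refine ⟨l.take p, l[p]'(by omega), l.drop (p + 1), ?_, by simp; omega, by simp; omega⟩
    rw [List.getElem_cons_drop, List.take_append_drop]
  have hX := (h.row_minor_bound n le_rfl p hp).1
  have h3 := hX s l₁ h₁ i a.1
  have h4 := hX.col h a.2 l₂ h₂ i a.1
  have hQ := h.Q_nonneg (2 * p + 1)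
  refine abs_le_of_sq_le_sq' ?_ (by positivity) |>.2
  refine (h.diag_sq_le s l₁ a l₂ i).trans ?_
  rw [sq]
  refine mul_le_mul h3 h4 ?_ (by positivity)
  exact Finset.sum_nonneg fun k _ => mul_nonneg (h.w_nonneg _ _) (sq_nonneg _)

end GoodSample

end Deterministic

/-! ### Resolvents of the band matrix, chains and symmetric loops -/

section Resolvent

/-- A kernel vector v would satisfy ⟨v, Hv⟩ = z |v|² with a real left-hand side, forcing Im z |v|² =
0. -/
theorem isUnit_sub_smul_one {I : Type*} [Fintype I] [DecidableEq I] {H : Matrix I I ℂ}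
    (hH : H.IsHermitian) {z : ℂ} (hz : z.im ≠ 0) : IsUnit (H - z • (1 : Matrix I I ℂ)) := by
  rw [Matrix.isUnit_iff_isUnit_det, isUnit_iff_ne_zero]
  intro h0
  obtain ⟨v, hv, h⟩ := Matrix.exists_mulVec_eq_zero_iff.2 h0
  rw [Matrix.sub_mulVec, Matrix.smul_mulVec, Matrix.one_mulVec, sub_eq_zero] at h
  have h1 := hH.im_star_dotProduct_mulVec_self v
  rw [h, dotProduct_smul, smul_eq_mul] at h1
  have h2 : (star v ⬝ᵥ v) = ((∑ i, ‖v i‖ ^ 2 : ℝ) : ℂ) := by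
    rw [dotProduct]
    push_cast
    refine Finset.sum_congr rfl fun i _ => ?_
    rw [Pi.star_apply, RCLike.star_def, Complex.conj_mul']
  rw [h2] at h1
  have h3 : z.im * ∑ i, ‖v i‖ ^ 2 = 0 := by
    change (z * ((∑ i, ‖v i‖ ^ 2 : ℝ) : ℂ)).im = 0 at h1
    rwa [Complex.im_mul_ofReal] at h1
  rcases mul_eq_zero.1 h3 with h4 | h4
  · exact hz h4
  · apply hv
    ext i
    have := (Finset.sum_eq_zero_iff_of_nonneg fun i _ => sq_nonneg ‖v i‖).1 h4 i (Finset.mem_univ i)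
    simpa using this

variable {L W : ℕ} [NeZero L]

/-- The spectral parameter of the resolvent of sign `s`. -/
noncomputable def specParam (z : ℂ) (s : Bool) : ℂ := if s then z else starRingEnd ℂ z

omit [NeZero L] in
theorem specParam_im {z : ℂ} (hz : z.im ≠ 0) (s : Bool) : (specParam z s).im ≠ 0 := by
  cases s <;> simpa [specParam] using hz

theorem green_eq (H : Matrix (Idx L W) (Idx L W) ℂ) (z : ℂ) (s : Bool) :
    green L W H z s = (H - specParam z s • (1 : Matrix (Idx L W) (Idx L W) ℂ))⁻¹ := by
  cases s <;> simp [green, specParam]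

theorem sub_mul_green {H : Matrix (Idx L W) (Idx L W) ℂ} (hH : H.IsHermitian) {z : ℂ}
    (hz : z.im ≠ 0) (s : Bool) :
    (H - specParam z s • (1 : Matrix (Idx L W) (Idx L W) ℂ)) * green L W H z s = 1 := by
  rw [green_eq]
  refine Matrix.mul_nonsing_inv _ ?_
  rw [← Matrix.isUnit_iff_isUnit_det]
  exact isUnit_sub_smul_one hH (specParam_im hz s)

theorem green_conjTranspose {H : Matrix (Idx L W) (Idx L W) ℂ} (hH : H.IsHermitian) (z : ℂ)
    (s : Bool) : (green L W H z s)ᴴ = green L W H z (!s) := by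
  rw [green_eq, green_eq, Matrix.conjTranspose_nonsing_inv, Matrix.conjTranspose_sub,
    Matrix.conjTranspose_smul, Matrix.conjTranspose_one, hH.eq]
  cases s <;> simp [specParam]

/-- The diagonal of the block projection `E_a`. -/
noncomputable def blockWeight (L W : ℕ) (a : ZMod L) (k : Idx L W) : ℝ :=
  if k.1 = a then (W : ℝ)⁻¹ else 0

omit [NeZero L] in
theorem blockE_eq (a : ZMod L) : blockE L W a = weightE (blockWeight L W) a := by
  unfold blockE weightE blockWeight
  congr 1
  ext k
  split_ifs <;> simp

theorem gChain_eq (H : Matrix (Idx L W) (Idx L W) ℂ) (z : ℂ) {k : ℕ} (σ : Fin (k + 1) → Bool)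
    (a : Fin k → ZMod L) :
    gChain L W H z σ a = chain (weightE (blockWeight L W)) (green L W H z) (σ 0)
      (List.ofFn fun j => (a j, σ j.succ)) := by
  have key : ∀ (s : Bool) (l : List (ZMod L × Bool)),
      green L W H z s * (l.map fun p => blockE L W p.1 * green L W H z p.2).prod =
        chain (weightE (blockWeight L W)) (green L W H z) s l := by
    intro s l
    induction l generalizing s with
    | nil => simp [chain]
    | cons p l ih =>
      rw [chain_cons, ← ih, List.map_cons, List.prod_cons, blockE_eq]
      simp only [Matrix.mul_assoc]
  rw [← key, List.map_ofFn]
  rfl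

theorem exists_prod_eq_chain_mul (H : Matrix (Idx L W) (Idx L W) ℂ) (z : ℂ) (s : Bool)
    (l : List (ZMod L × Bool)) (b : ZMod L) :
    ∃ (σ : Fin (l.length + 1) → Bool) (a : Fin (l.length + 1) → ZMod L),
      (List.ofFn fun k => green L W H z (σ k) * blockE L W (a k)).prod =
        chain (weightE (blockWeight L W)) (green L W H z) s l * weightE (blockWeight L W) b := by
  induction l generalizing s with
  | nil => exact ⟨fun _ => s, fun _ => b, by simp [chain, blockE_eq]⟩
  | cons p l ih =>
    obtain ⟨σ, a, h⟩ := ih p.2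
    refine ⟨Fin.cons s σ, Fin.cons p.1 a, ?_⟩
    rw [List.ofFn_succ, List.prod_cons]
    simp only [Fin.cons_zero, Fin.cons_succ]
    refine (congrArg (green L W H z s * blockE L W p.1 * ·) h).trans ?_
    rw [chain_cons, blockE_eq]
    simp only [Matrix.mul_assoc]

/-- The averages of a chain over two blocks form a symmetric loop of twice the length. -/
theorem exists_gLoop_eq {H : Matrix (Idx L W) (Idx L W) ℂ} (hH : H.IsHermitian) (z : ℂ) (s : Bool)
    (l : List (ZMod L × Bool)) (a b : ZMod L) {m : ℕ} (hm : m = 2 * l.length + 2) :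
    ∃ (σ : Fin m → Bool) (c : Fin m → ZMod L), gLoop L W H z σ c =
      ((∑ x, blockWeight L W a x * ∑ y, blockWeight L W b y *
        ‖chain (weightE (blockWeight L W)) (green L W H z) s l x y‖ ^ 2 : ℝ) : ℂ) := by
  obtain ⟨s', l', hl', he⟩ := exists_chain_conjTranspose (weightE (blockWeight L W))
    (green L W H z) (GoodSample.weightE_conjTranspose _) (green_conjTranspose hH z) s l
  set C := chain (weightE (blockWeight L W)) (green L W H z) s l with hC
  -- The loop is Tr(C E_b C* E_a), with the adjoint chain C* written as a chain of its own.
  obtain ⟨σ, c, h⟩ := exists_prod_eq_chain_mul H z s (l ++ (b, s') :: l') a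
  have hlen : m = (l ++ (b, s') :: l').length + 1 := by simp [hl']; omega
  subst hlen
  refine ⟨σ, c, ?_⟩
  rw [gLoop, h, chain_append, ← he, ← hC, Matrix.trace_mul_comm, Matrix.trace]
  push_cast
  refine Finset.sum_congr rfl fun x _ => ?_
  rw [Matrix.diag_apply, weightE, Matrix.diagonal_mul, Matrix.mul_apply]
  congr 1
  refine Finset.sum_congr rfl fun y _ => ?_
  rw [weightE, Matrix.mul_diagonal, Matrix.conjTranspose_apply, RCLike.star_def,
    mul_comm (C x y), mul_assoc, Complex.mul_conj']

theorem sum_blockWeight_le (hW : 0 < W) (a : ZMod L) (f : Idx L W → ℝ) (y : ℝ)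
    (h : ∀ x, f x ≤ y) : ∑ x, blockWeight L W a x * f x ≤ y := by
  have hW' : (0 : ℝ) < W := by exact_mod_cast hW
  have h1 : ∑ x, blockWeight L W a x = 1 := by
    unfold blockWeight
    rw [Fintype.sum_prod_type_right]
    simp [hW'.ne']
  calc _ ≤ ∑ x, blockWeight L W a x * y := by
        gcongr with x _
        · unfold blockWeight; split_ifs <;> positivity
        · exact h x
    _ = y := by rw [← Finset.sum_mul, h1, one_mul]

/-- Row i of S is at most one third of the sum of the three neighbouring block weights; only this
inequality is needed, not equality. -/
theorem sum_varS_le (i : Idx L W) (f : Idx L W → ℝ) (y : ℝ) (hf : ∀ x, 0 ≤ f x)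
    (hy : ∀ c, ∑ x, blockWeight L W c x * f x ≤ y) : ∑ x, varS L W i x * f x ≤ y := by
  have h1 : ∀ x, varS L W i x * f x ≤ (1 / 3) * (blockWeight L W i.1 x * f x +
      blockWeight L W (i.1 + 1) x * f x + blockWeight L W (i.1 - 1) x * f x) := by
    intro x
    rw [← add_mul, ← add_mul, ← mul_assoc]
    refine mul_le_mul_of_nonneg_right ?_ (hf x)
    unfold varS blockWeight
    have hW : (0 : ℝ) ≤ (W : ℝ)⁻¹ := by positivity
    rw [one_div, mul_inv]
    split_ifs <;> first | linarith | tauto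
  refine (Finset.sum_le_sum fun x _ => h1 x).trans ?_
  rw [← Finset.mul_sum, Finset.sum_add_distrib, Finset.sum_add_distrib]
  have := hy i.1
  have := hy (i.1 + 1)
  have := hy (i.1 - 1)
  linarith

end Resolvent

/-! ### The scale W ℓ η and the size function -/

section Parameters

theorem mE_im {E : ℝ} (hE : |E| < 2) : (mE E).im = Real.sqrt (4 - E ^ 2) / 2 := by
  rw [mE_eq hE]
  simp

theorem mE_im_pos {E : ℝ} (hE : |E| < 2) : 0 < (mE E).im := by
  have : 0 < 4 - E ^ 2 := by
    have := abs_lt.1 hE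
    nlinarith
  rw [mE_im hE]
  have := Real.sqrt_pos.2 this
  positivity

theorem norm_mE {E : ℝ} (hE : |E| < 2) : ‖mE E‖ = 1 := by
  have hpos : 0 < 4 - E ^ 2 := by
    have := abs_lt.1 hE
    nlinarith
  have h1 : ‖mE E‖ ^ 2 = 1 := by
    rw [← Complex.normSq_eq_norm_sq, Complex.normSq_apply, mE_im hE, mE_eq hE]
    simp
    nlinarith [Real.sq_sqrt hpos.le]
  nlinarith [norm_nonneg (mE E)]

theorem etaFlow_eq (E t : ℝ) : etaFlow E t = (1 - t) * (mE E).im := by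
  simp [etaFlow, zFlow]

/-- Since Im m ≤ 1, the product ℓ η is at most (1 - t)^(-1/2) (1 - t) ≤ 1. This makes W⁻¹ no larger
than the inverse scale, as `inv_mul_chainSize_le` requires. -/
theorem scale_le {L W : ℕ} {E t : ℝ} (hE : |E| < 2) (ht : 0 ≤ t) (ht' : t < 1) :
    scale L W E t ≤ W := by
  have h1 : (mE E).im ≤ 1 := (Complex.im_le_norm _).trans (norm_mE hE).le
  have h0 := (mE_im_pos hE).le
  have h2 : ellFlow L t ≤ (1 - t) ^ (-(1 / 2) : ℝ) := by
    have : |1 - t| = 1 - t := abs_of_pos (by linarith)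
    rw [ellFlow, this]
    exact min_le_left _ _
  have h3 : (1 - t) ^ (-(1 / 2) : ℝ) * (1 - t) ≤ 1 := by
    have h4 : (1 - t) ^ (-(1 / 2) : ℝ) * (1 - t) = (1 - t) ^ (1 / 2 : ℝ) := by
      nth_rw 2 [← Real.rpow_one (1 - t)]
      rw [← Real.rpow_add (by linarith)]
      norm_num
    rw [h4]
    exact Real.rpow_le_one (by linarith) (by linarith) (by norm_num)
  rw [scale, etaFlow_eq, mul_assoc]
  have h5 : ellFlow L t * ((1 - t) * (mE E).im) ≤ 1 := by
    calc _ ≤ (1 - t) ^ (-(1 / 2) : ℝ) * ((1 - t) * 1) := by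
          have : 0 ≤ (1 - t) ^ (-(1 / 2) : ℝ) := Real.rpow_nonneg (by linarith) _
          have : 0 ≤ 1 - t := by linarith
          gcongr
      _ ≤ 1 := by simpa using h3
  have hW : (0 : ℝ) ≤ W := Nat.cast_nonneg W
  nlinarith

theorem scale_nonneg {L W : ℕ} {E t : ℝ} (hE : |E| < 2) (ht' : t < 1) : 0 ≤ scale L W E t := by
  have h0 := (mE_im_pos hE).le
  have h2 : 0 ≤ ellFlow L t := le_min (by positivity) (Nat.cast_nonneg L)
  have : 0 ≤ 1 - t := by linarith
  rw [scale, etaFlow_eq]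
  positivity

theorem one_le_of_one_le_rpow {x : ℝ} (hx : 0 ≤ x) (h : 1 ≤ x ^ (1 / 4 : ℝ)) : 1 ≤ x := by
  by_contra hlt
  push Not at hlt
  have := Real.rpow_lt_one hx hlt (by norm_num : (0 : ℝ) < 1 / 4)
  linarith

/-- The size `(1 + α^j β⁻¹) s^(-j)` of the chains. -/
noncomputable def chainSize (α β s : ℝ) (j : ℕ) : ℝ := fBound (j + 1) α β * (s ^ j)⁻¹

theorem fBound_succ (j : ℕ) (α β : ℝ) : fBound (j + 1) α β = 1 + α ^ j * β⁻¹ := by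
  simp [fBound]

variable {α β s : ℝ}

theorem fBound_nonneg (hα : 1 ≤ α) (hβ : 1 ≤ β) (j : ℕ) : 0 ≤ fBound j α β := by
  unfold fBound
  positivity

theorem chainSize_nonneg (hα : 1 ≤ α) (hβ : 1 ≤ β) (hs : 1 ≤ s) (j : ℕ) :
    0 ≤ chainSize α β s j := by
  have := fBound_nonneg hα hβ (j + 1)
  unfold chainSize
  positivity

theorem one_le_chainSize_zero (hβ : 1 ≤ β) : 1 ≤ chainSize α β s 0 := by
  have : 0 ≤ β⁻¹ := by positivity
  simp [chainSize, fBound]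
  linarith

theorem chainSize_succ_le (hα : 1 ≤ α) (hβ : 1 ≤ β) (hs : 1 ≤ s) (hαs : α ≤ s) (j : ℕ) :
    chainSize α β s (j + 1) ≤ chainSize α β s j := by
  have hb : 0 ≤ β⁻¹ := by positivity
  unfold chainSize
  rw [fBound_succ, fBound_succ]
  have h1 : 1 + α ^ (j + 1) * β⁻¹ ≤ s * (1 + α ^ j * β⁻¹) := by
    have h2 : 0 ≤ α ^ j * β⁻¹ := by positivity
    rw [pow_succ]
    nlinarith
  calc _ ≤ s * (1 + α ^ j * β⁻¹) * (s ^ (j + 1))⁻¹ := by gcongr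
    _ = _ := by
      rw [pow_succ]
      field_simp

/-- Each of the three nontrivial terms of the product is at most α^(j+k) β⁻¹: the two single ones
because α ≥ 1, and the one with β⁻² because β ≥ 1. -/
theorem chainSize_mul_le (hα : 1 ≤ α) (hβ : 1 ≤ β) (hs : 1 ≤ s) (j k : ℕ) :
    chainSize α β s j * chainSize α β s k ≤ 3 * chainSize α β s (j + k) := by
  have hb : 0 ≤ β⁻¹ := by positivity
  have hb1 : β⁻¹ ≤ 1 := inv_le_one_of_one_le₀ hβ
  unfold chainSize
  simp only [fBound_succ]
  have h1 : α ^ j ≤ α ^ (j + k) := pow_le_pow_right₀ hα (by omega)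
  have h2 : α ^ k ≤ α ^ (j + k) := pow_le_pow_right₀ hα (by omega)
  have h3 : (1 + α ^ j * β⁻¹) * (1 + α ^ k * β⁻¹) ≤ 3 * (1 + α ^ (j + k) * β⁻¹) := by
    have e1 : α ^ j * β⁻¹ ≤ α ^ (j + k) * β⁻¹ := by gcongr
    have e2 : α ^ k * β⁻¹ ≤ α ^ (j + k) * β⁻¹ := by gcongr
    have e3 : α ^ j * β⁻¹ * (α ^ k * β⁻¹) ≤ α ^ (j + k) * β⁻¹ := by
      calc _ = α ^ (j + k) * β⁻¹ * β⁻¹ := by rw [pow_add]; ring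
        _ ≤ α ^ (j + k) * β⁻¹ * 1 := by gcongr
        _ = _ := mul_one _
    nlinarith
  calc _ = (1 + α ^ j * β⁻¹) * (1 + α ^ k * β⁻¹) * (s ^ (j + k))⁻¹ := by
        rw [pow_add, mul_inv]; ring
    _ ≤ 3 * (1 + α ^ (j + k) * β⁻¹) * (s ^ (j + k))⁻¹ := by gcongr
    _ = _ := by ring

theorem inv_mul_chainSize_le (hα : 1 ≤ α) (hβ : 1 ≤ β) (hs : 1 ≤ s) {r : ℝ} (hr : r ≤ s⁻¹)
    (j : ℕ) : r * chainSize α β s j ≤ chainSize α β s (j + 1) := by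
  refine (mul_le_mul_of_nonneg_right hr (chainSize_nonneg hα hβ hs j)).trans ?_
  unfold chainSize
  simp only [fBound_succ]
  have h1 : α ^ j ≤ α ^ (j + 1) := pow_le_pow_right₀ hα (by omega)
  calc _ = (1 + α ^ j * β⁻¹) * (s ^ (j + 1))⁻¹ := by rw [pow_succ, mul_inv]; ring
    _ ≤ _ := by gcongr

end Parameters

/-! ### From the random model to the deterministic conditions and back -/

section Sample

variable {L W : ℕ} [NeZero L]

theorem norm_le_maxNorm (A : Matrix (Idx L W) (Idx L W) ℂ) (i j : Idx L W) :
    ‖A i j‖ ≤ maxNorm L W A :=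
  (le_ciSup (f := fun j => ‖A i j‖) (Set.finite_range _).bddAbove j).trans
    (le_ciSup (f := fun i => ⨆ j, ‖A i j‖) (Set.finite_range _).bddAbove i)

theorem norm_gLoop_le (H : Matrix (Idx L W) (Idx L W) ℂ) (E t : ℝ) {m : ℕ} (hm : 1 ≤ m)
    (hs : 0 < scale L W E t)
    (σ : Fin m → Bool) (a : Fin m → ZMod L) :
    ‖gLoop L W H (zFlow E t) σ a‖ ≤ XiLoop L W H E t m * (scale L W E t ^ (m - 1))⁻¹ := by
  have h1 : ‖gLoop L W H (zFlow E t) σ a‖ ≤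
      ⨆ σ : Fin m → Bool, ⨆ a : Fin m → ZMod L, ‖gLoop L W H (zFlow E t) σ a‖ :=
    (le_ciSup (f := fun a => ‖gLoop L W H (zFlow E t) σ a‖) (Set.finite_range _).bddAbove a).trans
      (le_ciSup (f := fun σ : Fin m → Bool => ⨆ a : Fin m → ZMod L,
        ‖gLoop L W H (zFlow E t) σ a‖) (Set.finite_range _).bddAbove σ)
  have h2 : scale L W E t ^ ((m : ℝ) - 1) = scale L W E t ^ (m - 1) := by
    rw [← Real.rpow_natCast, Nat.cast_sub hm, Nat.cast_one]
  rw [XiLoop, h2, mul_inv_cancel_right₀ (by positivity)]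
  exact h1

/-- The entrywise bound is assumed for G(+) only and passes to G(-) by taking adjoints; the diagonal
is bounded above and below because |m| = 1 and ε ≤ 1/2. -/
theorem goodSample {H : Matrix (Idx L W) (Idx L W) ℂ} (hH : H.IsHermitian) {E t : ℝ} {n : ℕ}
    {B ε α β : ℝ} (hW : 0 < W) (hE : |E| < 2) (ht : 0 ≤ t) (ht' : t < 1) (hα : 1 ≤ α)
    (hβ : 1 ≤ β) (hα2 : α ^ 2 ≤ scale L W E t ^ (1 / 4 : ℝ)) (hB : 100 * ((n : ℝ) + 1) ≤ B)
    (hε : ε ≤ 1 / 2) (hδ : (ε ^ 2 + 4 * (W : ℝ)⁻¹) * B ^ 3 ≤ 1 / 2)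
    (hG : maxNorm L W (green L W H (zFlow E t) true -
      mE E • (1 : Matrix (Idx L W) (Idx L W) ℂ)) ≤ ε)
    (hloop : ∀ m, 2 ≤ m → m ≤ 2 * n → XiLoop L W H E t m ≤ B * fBound m α β)
    (hlde : ∀ i k, k ≠ i → ∀ s (l : List (ZMod L × Bool)), l.length < n →
      ‖∑ x, H i x * chain (weightE (blockWeight L W)) (minor (green L W H (zFlow E t)) i)
        s l x k‖ ^ 2 ≤ B * ∑ x, varS L W i x * ‖chain (weightE (blockWeight L W))
          (minor (green L W H (zFlow E t)) i) s l x k‖ ^ 2) :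
    GoodSample (blockWeight L W) (varS L W) H (green L W H (zFlow E t)) n B
      (ε ^ 2 + 4 * (W : ℝ)⁻¹) (W : ℝ)⁻¹ (chainSize α β (scale L W E t)) := by
  have hs0 := scale_nonneg (L := L) (W := W) hE ht'
  have hs : 1 ≤ scale L W E t := one_le_of_one_le_rpow hs0 (by nlinarith)
  -- From α ≤ α² ≤ s^(1/4) ≤ s, as s ≥ 1. This makes the sizes Q_j decreasing.
  have hαs : α ≤ scale L W E t := by
    have h1 : scale L W E t ^ (1 / 4 : ℝ) ≤ scale L W E t ^ (1 : ℝ) :=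
      Real.rpow_le_rpow_of_exponent_le hs (by norm_num)
    rw [Real.rpow_one] at h1
    nlinarith
  have hW' : (0 : ℝ) < W := by exact_mod_cast hW
  have hz : (zFlow E t).im ≠ 0 := by
    have h1 := etaFlow_eq E t
    rw [etaFlow] at h1
    rw [h1]
    have := mE_im_pos hE
    have : 0 < 1 - t := by linarith
    positivity
  have hm := norm_mE hE
  have hconj : ∀ i j, ‖green L W H (zFlow E t) false i j‖ = ‖green L W H (zFlow E t) true j i‖ := by
    intro i j
    have h1 := green_conjTranspose hH (zFlow E t) true
    rw [Bool.not_true] at h1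
    rw [← h1, Matrix.conjTranspose_apply, norm_star]
  have hoff' : ∀ i j, i ≠ j → ‖green L W H (zFlow E t) true i j‖ ≤ ε := by
    intro i j hij
    have h1 := (norm_le_maxNorm _ i j).trans hG
    simpa [Matrix.one_apply_ne hij] using h1
  have hoff : ∀ s i j, i ≠ j → ‖green L W H (zFlow E t) s i j‖ ≤ ε := by
    rintro (_ | _) i j hij
    · rw [hconj]
      exact hoff' j i hij.symm
    · exact hoff' i j hij
  have hdiag' : ∀ i, ‖green L W H (zFlow E t) true i i - mE E‖ ≤ 1 / 2 := by
    intro i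
    have h1 := (norm_le_maxNorm _ i i).trans (hG.trans hε)
    simpa using h1
  have hge : ∀ s i, 1 / 2 ≤ ‖green L W H (zFlow E t) s i i‖ := by
    have h0 : ∀ i, 1 / 2 ≤ ‖green L W H (zFlow E t) true i i‖ := fun i => by
      have h1 := norm_sub_norm_le (mE E) (mE E - green L W H (zFlow E t) true i i)
      rw [norm_sub_rev (mE E), sub_sub_cancel] at h1
      linarith [hdiag' i]
    rintro (_ | _) i
    · rw [hconj]
      exact h0 i
    · exact h0 i
  have hle : ∀ s i, ‖green L W H (zFlow E t) s i i‖ ≤ 2 := by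
    have h0 : ∀ i, ‖green L W H (zFlow E t) true i i‖ ≤ 2 := fun i => by
      have h1 := norm_le_norm_add_norm_sub (mE E) (green L W H (zFlow E t) true i i)
      have h2 := hdiag' i
      rw [norm_sub_rev] at h2
      linarith
    rintro (_ | _) i
    · rw [hconj]
      exact h0 i
    · exact h0 i
  refine
    { w_nonneg := fun a k => ?_
      w_le := fun a k => ?_
      adj := green_conjTranspose hH _
      res := ⟨specParam (zFlow E t), sub_mul_green hH hz⟩
      diag_ge := hge
      diag_le := hle
      off_le := fun s i j hij => ?_
      avg_le := fun s i a => ?_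
      var_le := sum_varS_le
      lde := hlde
      loop := fun s l hl a b => ?_
      Q_nonneg := chainSize_nonneg hα hβ hs
      Q_zero := one_le_chainSize_zero hβ
      Q_succ := chainSize_succ_le hα hβ hs hαs
      Q_mul := chainSize_mul_le hα hβ hs
      Q_r := inv_mul_chainSize_le hα hβ hs
        (inv_anti₀ (by linarith) (scale_le hE ht ht'))
      B_ge := hB
      δ_nonneg := by positivity
      δ_le := hδ }
  · unfold blockWeight; split_ifs <;> positivity
  · unfold blockWeight; split_ifs <;> [exact le_rfl; positivity]
  · have h1 : ‖green L W H (zFlow E t) s i j‖ ^ 2 ≤ ε ^ 2 :=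
      pow_le_pow_left₀ (norm_nonneg _) (hoff s i j hij) 2
    have : 0 ≤ 4 * (W : ℝ)⁻¹ := by positivity
    linarith
  · have h1 : ∀ k, blockWeight L W a k * ‖green L W H (zFlow E t) s i k‖ ^ 2 ≤
        blockWeight L W a k * ε ^ 2 + if k = i then 4 * (W : ℝ)⁻¹ else 0 := by
      intro k
      have hw0 : 0 ≤ blockWeight L W a k := by unfold blockWeight; split_ifs <;> positivity
      have hw1 : blockWeight L W a k ≤ (W : ℝ)⁻¹ := by
        unfold blockWeight; split_ifs <;> [exact le_rfl; positivity]
      by_cases hk : k = i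
      · subst hk
        rw [if_pos rfl]
        have h2 : ‖green L W H (zFlow E t) s k k‖ ^ 2 ≤ 4 := by
          nlinarith [hle s k, norm_nonneg (green L W H (zFlow E t) s k k)]
        have h3 : 0 ≤ blockWeight L W a k * ε ^ 2 := by positivity
        nlinarith
      · rw [if_neg hk, add_zero]
        exact mul_le_mul_of_nonneg_left
          (pow_le_pow_left₀ (norm_nonneg _) (hoff s i k (Ne.symm hk)) 2) hw0
    refine (Finset.sum_le_sum fun k _ => h1 k).trans ?_
    rw [Finset.sum_add_distrib]
    simp only [Finset.sum_ite_eq', Finset.mem_univ, if_true]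
    exact add_le_add_left (sum_blockWeight_le hW a _ _ fun _ => le_rfl) _
  · obtain ⟨σ, c, h⟩ := exists_gLoop_eq (m := 2 * l.length + 2) hH (zFlow E t) s l a b rfl
    have h1 := norm_gLoop_le H E t (m := 2 * l.length + 2) (by omega) (by linarith) σ c
    rw [h, Complex.norm_real] at h1
    refine (le_abs_self _).trans (h1.trans ?_)
    unfold chainSize
    rw [show 2 * l.length + 2 - 1 = 2 * l.length + 1 by omega, ← mul_assoc]
    gcongr
    exact hloop _ (by omega) (by omega)

theorem XiDiag_le {H : Matrix (Idx L W) (Idx L W) ℂ} {E t : ℝ} {n : ℕ} {B δ r α β : ℝ}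
    (hn : 1 ≤ n) (hα : 1 ≤ α) (hβ : 1 ≤ β) (hs : 0 < scale L W E t)
    (h : GoodSample (blockWeight L W) (varS L W) H (green L W H (zFlow E t)) n B δ r
      (chainSize α β (scale L W E t))) :
    XiDiag L W H E t (2 * n) ≤ B ^ 9 ^ n * fBound (2 * n) α β := by
  have hB : 0 ≤ B := by linarith [h.one_le_B]
  have hf := fBound_nonneg hα hβ (2 * n)
  have h1 : (⨆ σ : Fin ((2 * n - 1) + 1) → Bool, ⨆ a : Fin (2 * n - 1) → ZMod L, ⨆ i : Idx L W,
      ‖gChain L W H (zFlow E t) σ a i i‖) ≤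
      B ^ 9 ^ n * fBound (2 * n) α β * (scale L W E t ^ (2 * n - 1))⁻¹ := by
    refine Real.iSup_le (fun σ => Real.iSup_le (fun a => Real.iSup_le (fun i => ?_) ?_) ?_) ?_
    · rw [gChain_eq]
      have := h.diag_even_bound (p := n - 1) (by omega) (σ 0)
        (List.ofFn fun j => (a j, σ j.succ)) (by simp; omega) i
      refine this.trans (le_of_eq ?_)
      rw [chainSize, show 2 * (n - 1) + 1 + 1 = 2 * n by omega,
        show 2 * (n - 1) + 1 = 2 * n - 1 by omega, mul_assoc]
    all_goals positivity
  have h2 : scale L W E t ^ (((2 * n : ℕ) : ℝ) - 1) = scale L W E t ^ (2 * n - 1) := by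
    rw [← Real.rpow_natCast, Nat.cast_sub (by omega), Nat.cast_one]
  rw [XiDiag, h2]
  refine (mul_le_mul_of_nonneg_right h1 (by positivity)).trans (le_of_eq ?_)
  rw [inv_mul_cancel_right₀ (by positivity)]

theorem XiOff_le {H : Matrix (Idx L W) (Idx L W) ℂ} {E t : ℝ} {n : ℕ} {B δ r α β : ℝ}
    (hn : 1 ≤ n) (hα : 1 ≤ α) (hβ : 1 ≤ β) (hs : 0 < scale L W E t)
    (h : GoodSample (blockWeight L W) (varS L W) H (green L W H (zFlow E t)) n B δ r
      (chainSize α β (scale L W E t))) :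
    XiOff L W H E t n ≤ B ^ 9 ^ (n + n) * fBound (2 * n) α β ^ (1 / 2 : ℝ) := by
  have hB1 : 1 ≤ B := by linarith [h.one_le_B]
  have hf := fBound_nonneg hα hβ (2 * n)
  have hBp : 1 ≤ B ^ 9 ^ (n + n) := one_le_pow₀ hB1
  have h0 : 0 ≤ fBound (2 * n) α β ^ (1 / 2 : ℝ) := by positivity
  have h1 : (⨆ σ : Fin ((n - 1) + 1) → Bool, ⨆ a : Fin (n - 1) → ZMod L,
      ⨆ p : {p : Idx L W × Idx L W // p.1 ≠ p.2},
      ‖gChain L W H (zFlow E t) σ a p.1.1 p.1.2‖) ≤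
      B ^ 9 ^ (n + n) * fBound (2 * n) α β ^ (1 / 2 : ℝ) *
        (scale L W E t ^ ((n : ℝ) - 1 / 2))⁻¹ := by
    refine Real.iSup_le (fun σ => Real.iSup_le (fun a => Real.iSup_le (fun p => ?_) ?_) ?_) ?_
    · rw [gChain_eq]
      have := h.off_diag_bound p.2 (σ 0) (List.ofFn fun j => (a j, σ j.succ)) (by simp; omega)
      rw [List.length_ofFn, chainSize, show 2 * (n - 1) + 1 + 1 = 2 * n by omega,
        show 2 * (n - 1) + 1 = 2 * n - 1 by omega] at this
      -- Comparing squares turns the exponent n - 1/2 into 2n - 1 and f^(1/2) into f.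
      refine abs_le_of_sq_le_sq' (this.trans ?_) (by positivity) |>.2
      have e1 : (fBound (2 * n) α β ^ (1 / 2 : ℝ)) ^ 2 = fBound (2 * n) α β := by
        rw [← Real.rpow_natCast, ← Real.rpow_mul hf]
        norm_num
      have e2 : ((scale L W E t ^ ((n : ℝ) - 1 / 2)) ^ 2) = scale L W E t ^ (2 * n - 1) := by
        rw [← Real.rpow_natCast, ← Real.rpow_mul hs.le, ← Real.rpow_natCast,
          Nat.cast_sub (by omega)]
        congr 1
        push_cast
        ring
      rw [mul_pow, mul_pow, inv_pow, e1, e2, mul_assoc]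
      gcongr
      exact le_self_pow₀ hBp (by norm_num)
    all_goals positivity
  rw [XiOff]
  refine (mul_le_mul_of_nonneg_right h1 (by positivity)).trans (le_of_eq ?_)
  rw [inv_mul_cancel_right₀ (by positivity)]

end Sample

/-! ### Gaussian large deviations -/

section Gaussian

theorem hasSubgaussianMGF_id_gaussianReal (v : ℝ≥0) :
    HasSubgaussianMGF id v (gaussianReal 0 v) where
  integrable_exp_mul t := integrable_exp_mul_gaussianReal t
  mgf_le t := by simp [mgf_id_gaussianReal]

/-- Re((a + ib) x) = a Re x - b Im x is a combination of two independent N(0, v/2) variables, so the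
proxies add up to |x|² v/2. -/
theorem hasSubgaussianMGF_re_mul {Ω : Type*} [MeasurableSpace Ω] {P : Measure Ω} {Z : Ω → ℂ}
    {v : ℝ≥0} (hZ : HasLaw Z (complexGaussian v) P) (x : ℂ) :
    HasSubgaussianMGF (fun ω => (Z ω * x).re) (‖x‖₊ ^ 2 * (v / 2)) P := by
  set g := gaussianReal 0 (v / 2) with hg
  have hid : HasSubgaussianMGF id (v / 2) g := hasSubgaussianMGF_id_gaussianReal _
  have h1 : HasSubgaussianMGF (fun p : ℝ × ℝ => p.1) (v / 2) (g.prod g) := by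
    rw [← HasSubgaussianMGF.id_map_iff (by fun_prop), ← Measure.fst, Measure.fst_prod]
    exact hid
  have h2 : HasSubgaussianMGF (fun p : ℝ × ℝ => p.2) (v / 2) (g.prod g) := by
    rw [← HasSubgaussianMGF.id_map_iff (by fun_prop), ← Measure.snd, Measure.snd_prod]
    exact hid
  have h3 := (h1.const_mul x.re).add_of_indepFun (h2.const_mul (-x.im))
    (indepFun_prod (measurable_const_mul x.re) (measurable_const_mul (-x.im)))
  have hmeas : Measurable fun p : ℝ × ℝ => (p.1 : ℂ) + (p.2 : ℂ) * Complex.I := by fun_prop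
  have h4 : HasSubgaussianMGF (fun z : ℂ => (z * x).re) (‖x‖₊ ^ 2 * (v / 2)) (complexGaussian v) := by
    rw [← HasSubgaussianMGF.id_map_iff (by fun_prop), complexGaussian,
      Measure.map_map (by fun_prop) hmeas, HasSubgaussianMGF.id_map_iff (by fun_prop)]
    convert h3 using 1
    · ext p
      simp
      ring
    · refine NNReal.eq ?_
      change ‖x‖ ^ 2 * ((v : ℝ) / 2) = x.re ^ 2 * (v / 2) + (-x.im) ^ 2 * (v / 2)
      rw [← Complex.normSq_eq_norm_sq, Complex.normSq_apply]
      ring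
  rw [← hZ.map_eq] at h4
  exact HasSubgaussianMGF.of_map (X := fun z : ℂ => (z * x).re) hZ.aemeasurable h4

theorem measureReal_sq_gt_le {Ω : Type*} [MeasurableSpace Ω] {P : Measure Ω}
    [IsProbabilityMeasure P] {X : Ω → ℝ} {c : ℝ≥0} (hX : HasSubgaussianMGF X c P) {b : ℝ}
    (hb : 0 ≤ b) : P.real {ω | 2 * b * c < X ω ^ 2} ≤ 2 * Real.exp (-b) := by
  -- At c = 0 the exponent of the tail bound degenerates; the variable is then almost surely zero,
  -- so the strict inequality fails.
  by_cases hc : c = 0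
  · subst hc
    have h0 := hX.ae_eq_zero_of_hasSubgaussianMGF_zero
    have h1 : P {ω | 2 * b * ((0 : ℝ≥0) : ℝ) < X ω ^ 2} = 0 := by
      refine measure_mono_null (fun ω hω => ?_) h0
      simp only [Set.mem_ofPred_eq, NNReal.coe_zero, mul_zero] at hω
      simp only [Set.mem_compl_iff, Set.mem_ofPred_eq]
      intro h2
      rw [h2] at hω
      simp at hω
    rw [measureReal_def, h1]
    simp [Real.exp_nonneg]
  · have hc' : (0 : ℝ) < c := by positivity
    have hsq : Real.sqrt (2 * b * c) ^ 2 = 2 * b * c := Real.sq_sqrt (by positivity)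
    have he : -Real.sqrt (2 * b * c) ^ 2 / (2 * (c : ℝ)) = -b := by
      rw [hsq]
      field_simp
    have h1 := hX.measure_ge_le (Real.sqrt_nonneg (2 * b * c))
    have h2 := hX.neg.measure_ge_le (Real.sqrt_nonneg (2 * b * c))
    rw [he] at h1 h2
    refine (measureReal_mono (fun ω hω => ?_) (by finiteness)).trans
      ((measureReal_union_le _ _).trans ((add_le_add h1 h2).trans_eq (two_mul _).symm))
    simp only [Set.mem_ofPred_eq] at hω
    have h3 : Real.sqrt (2 * b * c) ≤ |X ω| := by
      rw [← Real.sqrt_sq_eq_abs]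
      exact Real.sqrt_le_sqrt hω.le
    rcases le_abs.1 h3 with h4 | h4
    · exact Or.inl h4
    · exact Or.inr h4

/-- Large deviations of a linear form in independent complex Gaussian variables. -/
theorem measureReal_linear_form_le {Ω U : Type*} [MeasurableSpace Ω] {P : Measure Ω}
    [IsProbabilityMeasure P] {Z : U → Ω → ℂ} (hind : iIndepFun Z P) {T : Finset U} {v : U → ℝ≥0}
    (hZ : ∀ u ∈ T, HasLaw (Z u) (complexGaussian (v u)) P) {V : U → ℝ} (hV : ∀ u ∈ T, v u ≤ V u)
    (x : U → ℂ) {b : ℝ} (hb : 0 ≤ b) :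
    P.real {ω | b * ∑ u ∈ T, V u * ‖x u‖ ^ 2 < ‖∑ u ∈ T, Z u ω * x u‖ ^ 2} ≤
      4 * Real.exp (-(b / 2)) := by
  have key : ∀ y : U → ℂ, (∀ u, ‖y u‖ = ‖x u‖) →
      P.real {ω | b / 2 * ∑ u ∈ T, V u * ‖x u‖ ^ 2 < (∑ u ∈ T, Z u ω * y u).re ^ 2} ≤
        2 * Real.exp (-(b / 2)) := by
    intro y hy
    have hi : iIndepFun (fun u ω => (Z u ω * y u).re) P :=
      hind.comp (fun u z => (z * y u).re) (fun u => by fun_prop)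
    have h1 := HasSubgaussianMGF.sum_of_iIndepFun hi (s := T)
      (fun u hu => hasSubgaussianMGF_re_mul (hZ u hu) (y u))
    refine (measureReal_mono (fun ω hω => ?_) (by finiteness)).trans
      (measureReal_sq_gt_le h1 (b := b / 2) (by positivity))
    simp only [Set.mem_ofPred_eq, Complex.re_sum] at hω ⊢
    refine lt_of_le_of_lt ?_ hω
    rw [mul_comm 2 (b / 2), mul_assoc]
    refine mul_le_mul_of_nonneg_left ?_ (by positivity)
    push_cast
    rw [Finset.mul_sum]
    refine Finset.sum_le_sum fun u hu => ?_
    rw [hy u]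
    have h2 := mul_le_mul_of_nonneg_right (hV u hu) (sq_nonneg ‖x u‖)
    linarith
  have h1 := key x fun u => rfl
  -- Multiplying by -i moves the imaginary part into the real part. If the squared modulus exceeds
  -- the threshold, one of the two squares exceeds half of it.
  have h2 := key (fun u => -Complex.I * x u) fun u => by simp
  refine (measureReal_mono (fun ω hω => ?_) (by finiteness)).trans
    ((measureReal_union_le _ _).trans ((add_le_add h1 h2).trans_eq (by ring)))
  simp only [Set.mem_ofPred_eq] at hω
  have h3 : (∑ u ∈ T, Z u ω * (-Complex.I * x u)).re = (∑ u ∈ T, Z u ω * x u).im := by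
    have : ∑ u ∈ T, Z u ω * (-Complex.I * x u) = -Complex.I * ∑ u ∈ T, Z u ω * x u := by
      rw [Finset.mul_sum]
      refine Finset.sum_congr rfl fun u _ => ?_
      ring
    rw [this]
    simp
  rw [← Complex.normSq_eq_norm_sq, Complex.normSq_apply] at hω
  by_contra hcon
  simp only [Set.mem_union, Set.mem_ofPred_eq, not_or, not_lt, h3] at hcon
  nlinarith [hcon.1, hcon.2]

/-- A bound on a joint event for independent variables from bounds on its sections. -/
theorem measureReal_le_of_indepFun {Ω 𝓧 𝓨 : Type*} [MeasurableSpace Ω] [MeasurableSpace 𝓧]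
    [MeasurableSpace 𝓨] {P : Measure Ω} [IsProbabilityMeasure P] {X : Ω → 𝓧} {Y : Ω → 𝓨}
    (hX : AEMeasurable X P) (hY : AEMeasurable Y P) (hind : IndepFun X Y P)
    {s : Set (𝓧 × 𝓨)} (hs : MeasurableSet s) {C : ℝ} (hC : 0 ≤ C)
    (h : ∀ y, P.real {ω | (X ω, y) ∈ s} ≤ C) : P.real {ω | (X ω, Y ω) ∈ s} ≤ C := by
  have hpX := Measure.isProbabilityMeasure_map hX
  have hpY := Measure.isProbabilityMeasure_map hY
  have h1 : P {ω | (X ω, Y ω) ∈ s} = P.map (fun ω => (X ω, Y ω)) s := by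
    rw [Measure.map_apply_of_aemeasurable (hX.prodMk hY) hs]
    rfl
  have h2 : P {ω | (X ω, Y ω) ∈ s} ≤ ENNReal.ofReal C := by
    rw [h1, (indepFun_iff_map_prod_eq_prod_map_map hX hY).1 hind, Measure.prod_apply_symm hs]
    calc _ ≤ ∫⁻ _, ENNReal.ofReal C ∂(P.map Y) := by
          refine lintegral_mono fun y => ?_
          rw [Measure.map_apply_of_aemeasurable hX (measurable_prodMk_right hs),
            ← ofReal_measureReal]
          exact ENNReal.ofReal_le_ofReal (h y)
      _ = ENNReal.ofReal C := by simp
  exact ENNReal.toReal_le_of_le_ofReal hC h2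

end Gaussian

/-! ### The minor as the resolvent of the cut matrix -/

section Minor

variable {I : Type*} [Fintype I] [DecidableEq I]

omit [Fintype I] in
/-- The matrix `H` with row and column `i` replaced by zero. -/
def cutMatrix (H : Matrix I I ℂ) (i : I) : Matrix I I ℂ :=
  Matrix.of fun x y => if x = i ∨ y = i then 0 else H x y

omit [Fintype I] in
theorem cutMatrix_isHermitian {H : Matrix I I ℂ} (hH : H.IsHermitian) (i : I) :
    (cutMatrix H i).IsHermitian := by
  ext x y
  simp only [Matrix.conjTranspose_apply, cutMatrix, Matrix.of_apply, or_comm (a := y = i)]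
  split_ifs
  · simp
  · exact hH.apply x y

/-- This exhibits the minor as a function of the cut matrix alone. The resolvent of the cut matrix
still has an entry at (i, i); the factor 1 - e_i e_iᵀ removes it. -/
theorem minor_eq_inv {G : Bool → Matrix I I ℂ} {H : Matrix I I ℂ} (hH : H.IsHermitian)
    {i : I} {s : Bool} {ζ : ℂ} (hζ : ζ.im ≠ 0) (hG : (H - ζ • (1 : Matrix I I ℂ)) * G s = 1)
    (h : G s i i ≠ 0) :
    minor G i s = (cutMatrix H i - ζ • (1 : Matrix I I ℂ))⁻¹ * (1 - Matrix.single i i 1) := by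
  have hu := isUnit_sub_smul_one (cutMatrix_isHermitian hH i) hζ
  have key : (cutMatrix H i - ζ • (1 : Matrix I I ℂ)) * minor G i s =
      1 - Matrix.single i i 1 := by
    have h1 : (H - ζ • (1 : Matrix I I ℂ)) * minor G i s =
        1 - 1 * Matrix.single i i (G s i i)⁻¹ * G s := by
      rw [minor, Matrix.mul_sub, ← Matrix.mul_assoc, ← Matrix.mul_assoc, hG]
    ext x y
    by_cases hx : x = i
    · subst hx
      rw [Matrix.sub_mul, Matrix.sub_apply, Matrix.smul_mul, Matrix.one_mul, Matrix.smul_apply,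
        minor_row h, Matrix.mul_apply, Matrix.sub_apply]
      by_cases hy : y = x
      · subst hy
        simp [cutMatrix]
      · simp [cutMatrix, Matrix.one_apply_ne (Ne.symm hy), Ne.symm hy]
    · have h2 := congrFun (congrFun h1 x) y
      rw [Matrix.sub_apply, mul_single_mul_apply, Matrix.one_apply_ne hx, zero_mul, zero_mul,
        sub_zero] at h2
      rw [Matrix.sub_apply, Matrix.single_apply_of_row_ne (Ne.symm hx), sub_zero, ← h2,
        Matrix.sub_mul, Matrix.sub_mul, Matrix.sub_apply, Matrix.sub_apply, Matrix.mul_apply,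
        Matrix.mul_apply]
      congr 1
      refine Finset.sum_congr rfl fun u _ => ?_
      by_cases hu : u = i
      · subst hu
        simp [minor_row h]
      · simp [cutMatrix, hx, hu]
  rw [← key, Matrix.nonsing_inv_mul_cancel_left _ _ ((Matrix.isUnit_iff_isUnit_det _).1 hu)]

/-- Pair (H - ζ) v = e_i with v = G e_i. If v_i = 0, the imaginary part gives Im ζ |v|² = 0, so v =
0, contradicting the equation. Minors are thus defined for every sample, not only for good ones. -/
theorem resolvent_diag_ne {G : Matrix I I ℂ} {H : Matrix I I ℂ} (hH : H.IsHermitian)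
    {ζ : ℂ} (hζ : ζ.im ≠ 0) (hG : (H - ζ • (1 : Matrix I I ℂ)) * G = 1) (i : I) :
    G i i ≠ 0 := by
  intro h0
  set v : I → ℂ := fun x => G x i with hv
  have h1 : (H - ζ • (1 : Matrix I I ℂ)) *ᵥ v = Pi.single i 1 := by
    ext x
    have := congrFun (congrFun hG x) i
    rw [Matrix.mul_apply] at this
    rw [Matrix.mulVec, dotProduct, this, Matrix.one_apply, Pi.single_apply]
  rw [Matrix.sub_mulVec, Matrix.smul_mulVec, Matrix.one_mulVec] at h1
  have h2 := congrArg (fun u => (star v ⬝ᵥ u).im) h1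
  simp only [dotProduct_sub, dotProduct_smul, smul_eq_mul, dotProduct_single_one, Pi.star_apply,
    hv, h0, star_zero, Complex.zero_im, Complex.sub_im] at h2
  rw [← hv] at h2
  have h3 : (star v ⬝ᵥ H *ᵥ v).im = 0 := hH.im_star_dotProduct_mulVec_self v
  have h4 : (star v ⬝ᵥ v) = ((∑ i, ‖v i‖ ^ 2 : ℝ) : ℂ) := by
    rw [dotProduct]
    push_cast
    refine Finset.sum_congr rfl fun i _ => ?_
    rw [Pi.star_apply, RCLike.star_def, Complex.conj_mul']
  rw [h3, h4, Complex.im_mul_ofReal, zero_sub, neg_eq_zero] at h2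
  have h5 : ∀ x, v x = 0 := by
    intro x
    have := (Finset.sum_eq_zero_iff_of_nonneg fun i _ => sq_nonneg ‖v i‖).1
      ((mul_eq_zero.1 h2).resolve_left hζ) x (Finset.mem_univ x)
    simpa using this
  have h6 : v = 0 := funext h5
  rw [h6] at h1
  have := congrFun h1 i
  simp at this

end Minor

/-! ### Measurability of inverses and chains -/

section Measurability

variable {Θ : Type*} [MeasurableSpace Θ] {I : Type*} [Fintype I] [DecidableEq I]

omit [DecidableEq I] in
theorem measurable_mul_apply {F K : Θ → Matrix I I ℂ} (hF : ∀ x y, Measurable fun θ => F θ x y)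
    (hK : ∀ x y, Measurable fun θ => K θ x y) (x y : I) :
    Measurable fun θ => (F θ * K θ) x y := by
  simp only [Matrix.mul_apply]
  exact Finset.measurable_sum _ fun u _ => (hF x u).mul (hK u y)

theorem measurable_det {F : Θ → Matrix I I ℂ} (hF : ∀ x y, Measurable fun θ => F θ x y) :
    Measurable fun θ => (F θ).det := by
  simp only [Matrix.det_apply]
  exact Finset.measurable_sum _ fun σ _ =>
    (Finset.measurable_prod _ fun u _ => hF (σ u) u).const_smul _

/-- By Cramer's rule each entry is a quotient of determinants, which are polynomials in the entries.
-/
theorem measurable_inv_apply {F : Θ → Matrix I I ℂ} (hF : ∀ x y, Measurable fun θ => F θ x y)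
    (x y : I) : Measurable fun θ => (F θ)⁻¹ x y := by
  simp only [Matrix.inv_def, Ring.inverse_eq_inv', Matrix.smul_apply, smul_eq_mul,
    Matrix.adjugate_apply]
  refine (measurable_det hF).inv.mul (measurable_det fun u v => ?_)
  by_cases hu : u = y
  · subst hu
    simp only [Matrix.updateRow_self]
    exact measurable_const
  · simp only [Matrix.updateRow_ne hu]
    exact hF u v

omit [DecidableEq I] in
theorem measurable_chain_apply {A : Type*} (E : A → Matrix I I ℂ) {K : Θ → Bool → Matrix I I ℂ}
    (hK : ∀ s x y, Measurable fun θ => K θ s x y) (s : Bool) (l : List (A × Bool)) (x y : I) :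
    Measurable fun θ => chain E (K θ) s l x y := by
  induction l generalizing s x y with
  | nil => exact hK s x y
  | cons p l ih =>
    simp only [chain_cons]
    have h1 : ∀ x y, Measurable fun θ => (K θ s * E p.1) x y :=
      measurable_mul_apply (F := fun θ => K θ s) (K := fun _ => E p.1) (hK s)
        (fun _ _ => measurable_const)
    exact measurable_mul_apply (F := fun θ => K θ s * E p.1)
      (K := fun θ => chain E (K θ) p.2 l) h1 (fun x y => ih p.2 x y) x y

end Measurability

/-! ### Independence of a row from its minor, and concentration -/

section RowConcentration

variable {L W : ℕ} [NeZero L] {t : ℝ} {Ω : Type*} [MeasurableSpace Ω] {P : Measure Ω}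
  [IsProbabilityMeasure P] {H : Ω → Matrix (Idx L W) (Idx L W) ℂ}

/-- The pairs of indices on and above the diagonal. -/
abbrev UpperPair (L W : ℕ) : Type := {p : Idx L W × Idx L W // pos L W p.1 ≤ pos L W p.2}

/-- The ordered pair formed by `i` and `u`. -/
def orderedPair (L W : ℕ) (i u : Idx L W) : UpperPair L W :=
  if h : pos L W i ≤ pos L W u then ⟨(i, u), h⟩ else ⟨(u, i), (not_le.1 h).le⟩

omit [NeZero L] in
theorem orderedPair_injective (i : Idx L W) : Function.Injective (orderedPair L W i) := by
  intro u v h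
  unfold orderedPair at h
  split_ifs at h <;> simp only [Subtype.mk.injEq, Prod.mk.injEq] at h
  · exact h.2
  · exact h.2.trans h.1
  · exact h.1.trans h.2
  · exact h.1

/-- The entry `(x, y)` of a Hermitian matrix as a function of the corresponding entry on or above
the diagonal. -/
noncomputable def entryOf (L W : ℕ) (x y : Idx L W) (c : ℂ) : ℂ :=
  if pos L W x ≤ pos L W y then c else starRingEnd ℂ c

omit [NeZero L] in
theorem measurable_entryOf (x y : Idx L W) : Measurable (entryOf L W x y) := by
  unfold entryOf
  split_ifs
  · exact measurable_id
  · exact Complex.continuous_conj.measurable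

omit [NeZero L] in
theorem entryOf_orderedPair {M : Matrix (Idx L W) (Idx L W) ℂ} (hM : M.IsHermitian)
    (x y : Idx L W) :
    entryOf L W x y (M (orderedPair L W x y).1.1 (orderedPair L W x y).1.2) = M x y := by
  unfold entryOf orderedPair
  split_ifs
  · rfl
  · exact hM.apply x y

omit [NeZero L] [IsProbabilityMeasure P] in
theorem IsBandMatrixAt.iIndepFun_row (hH : IsBandMatrixAt L W t P H) (i : Idx L W) :
    iIndepFun (fun u ω => H ω i u) P := by
  have h1 := (hH.indep.precomp (orderedPair_injective i)).comp (fun u => entryOf L W i u)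
    (fun u => measurable_entryOf i u)
  convert h1 using 2 with u
  ext ω
  exact (entryOf_orderedPair (hH.isHermitian ω) i u).symm

omit [NeZero L] [IsProbabilityMeasure P] in
theorem IsBandMatrixAt.aemeasurable (hH : IsBandMatrixAt L W t P H) (i j : Idx L W) :
    AEMeasurable (fun ω => H ω i j) P := by
  by_cases h : i = j
  · subst h
    exact (hH.law_diag i).aemeasurable
  · exact (hH.law_offDiag i j h).aemeasurable

-- The independent entries on and above the diagonal split into those whose pair contains i and
-- those whose pair does not. The row is a function of the former and the cut matrix of the latter.
omit [IsProbabilityMeasure P] in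
theorem IsBandMatrixAt.indepFun_row_cut (hH : IsBandMatrixAt L W t P H) (i : Idx L W)
    {𝓨 : Type*} [MeasurableSpace 𝓨] (F : Matrix (Idx L W) (Idx L W) ℂ → 𝓨)
    (hF : ∀ {Θ : Type} [MeasurableSpace Θ] (K : Θ → Matrix (Idx L W) (Idx L W) ℂ),
      (∀ x y, Measurable fun θ => K θ x y) → Measurable fun θ => F (K θ)) :
    AEMeasurable (fun ω => F (cutMatrix (H ω) i)) P ∧
      IndepFun (fun ω u => H ω i u) (fun ω => F (cutMatrix (H ω) i)) P := by
  classical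
  let S : Finset (UpperPair L W) := Finset.univ.filter fun p => p.1.1 = i ∨ p.1.2 = i
  let T : Finset (UpperPair L W) := Finset.univ.filter fun p => ¬(p.1.1 = i ∨ p.1.2 = i)
  have hST : Disjoint S T := Finset.disjoint_filter_filter_not _ _ _
  have hmem : ∀ u, orderedPair L W i u ∈ S := by
    intro u
    simp only [S, Finset.mem_filter, Finset.mem_univ, true_and]
    unfold orderedPair
    split_ifs <;> simp
  have hmem' : ∀ x y, ¬(x = i ∨ y = i) → orderedPair L W x y ∈ T := by
    intro x y hxy
    simp only [T, Finset.mem_filter, Finset.mem_univ, true_and]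
    unfold orderedPair
    split_ifs
    · exact hxy
    · exact fun h => hxy h.symm
  have hm : ∀ p : UpperPair L W, AEMeasurable (fun ω => H ω p.1.1 p.1.2) P :=
    fun p => hH.aemeasurable _ _
  have hind := hH.indep.indepFun_finset₀ S T hST hm
  let R : (S → ℂ) → Idx L W → ℂ := fun θ u => entryOf L W i u (θ ⟨orderedPair L W i u, hmem u⟩)
  have hR : Measurable R := measurable_pi_lambda _ fun u =>
    (measurable_entryOf i u).comp (measurable_pi_apply _)
  let K : (T → ℂ) → Matrix (Idx L W) (Idx L W) ℂ := fun θ => Matrix.of fun x y =>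
    if h : x = i ∨ y = i then 0 else entryOf L W x y (θ ⟨orderedPair L W x y, hmem' x y h⟩)
  have hK : ∀ x y, Measurable fun θ => K θ x y := by
    intro x y
    simp only [K, Matrix.of_apply]
    split_ifs with h
    · exact measurable_const
    · exact (measurable_entryOf x y).comp (measurable_pi_apply _)
  have hFK := hF K hK
  have hRe : (fun ω u => H ω i u) = R ∘ fun ω (p : S) => H ω p.1.1.1 p.1.1.2 := by
    ext ω u
    exact (entryOf_orderedPair (hH.isHermitian ω) i u).symm
  have hFe : (fun ω => F (cutMatrix (H ω) i)) =
      (fun θ => F (K θ)) ∘ fun ω (p : T) => H ω p.1.1.1 p.1.1.2 := by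
    ext ω
    simp only [Function.comp]
    congr 1
    ext x y
    simp only [cutMatrix, K, Matrix.of_apply]
    split_ifs with h
    · rfl
    · exact (entryOf_orderedPair (hH.isHermitian ω) x y).symm
  rw [hRe, hFe]
  exact ⟨hFK.comp_aemeasurable (aemeasurable_pi_lambda _ fun p => hm p.1), hind.comp hR hFK⟩

/-- Concentration of a row of `H` against a chain of resolvent minors. -/
theorem IsBandMatrixAt.row_concentration (hH : IsBandMatrixAt L W t P H) (ht : 0 ≤ t)
    (ht' : t ≤ 1) {z : ℂ} (hz : z.im ≠ 0) (i k : Idx L W) (s : Bool)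
    (l : List (ZMod L × Bool)) {b : ℝ} (hb : 0 ≤ b) :
    P.real {ω | b * ∑ x, varS L W i x * ‖chain (weightE (blockWeight L W))
        (minor (green L W (H ω) z) i) s l x k‖ ^ 2 <
      ‖∑ x, H ω i x * chain (weightE (blockWeight L W))
        (minor (green L W (H ω) z) i) s l x k‖ ^ 2} ≤ 4 * Real.exp (-(b / 2)) := by
  let K : Matrix (Idx L W) (Idx L W) ℂ → Bool → Matrix (Idx L W) (Idx L W) ℂ := fun M s =>
    (M - specParam z s • (1 : Matrix (Idx L W) (Idx L W) ℂ))⁻¹ * (1 - Matrix.single i i 1)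
  let F : Matrix (Idx L W) (Idx L W) ℂ → Idx L W → ℂ := fun M x =>
    chain (weightE (blockWeight L W)) (K M) s l x k
  have hne : ∀ ω s, green L W (H ω) z s i i ≠ 0 := fun ω s =>
    resolvent_diag_ne (hH.isHermitian ω) (specParam_im hz s)
      (sub_mul_green (hH.isHermitian ω) hz s) i
  have hK : ∀ ω, minor (green L W (H ω) z) i = K (cutMatrix (H ω) i) := by
    intro ω
    ext1 s
    exact minor_eq_inv (hH.isHermitian ω) (specParam_im hz s)
      (sub_mul_green (hH.isHermitian ω) hz s) (hne ω s)
  have hF : ∀ {Θ : Type} [MeasurableSpace Θ] (M : Θ → Matrix (Idx L W) (Idx L W) ℂ),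
      (∀ x y, Measurable fun θ => M θ x y) → Measurable fun θ => F (M θ) := by
    intro Θ _ M hM
    refine measurable_pi_lambda _ fun x => ?_
    refine measurable_chain_apply (K := fun θ => K (M θ)) _ (fun s x y => ?_) s l x k
    have h1 : ∀ x y, Measurable fun θ =>
        (M θ - specParam z s • (1 : Matrix (Idx L W) (Idx L W) ℂ)) x y := fun x y =>
      (hM x y).sub measurable_const
    exact measurable_mul_apply
      (F := fun θ => (M θ - specParam z s • (1 : Matrix (Idx L W) (Idx L W) ℂ))⁻¹)
      (K := fun _ => 1 - Matrix.single i i 1)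
      (measurable_inv_apply h1) (fun _ _ => measurable_const) x y
  obtain ⟨hFm, hind⟩ := hH.indepFun_row_cut i F hF
  have hrow : AEMeasurable (fun ω u => H ω i u) P :=
    aemeasurable_pi_lambda _ fun u => hH.aemeasurable i u
  -- The index i is left out because H_ii is real rather than circular complex; nothing is lost,
  -- since the chain of minors vanishes in row i.
  let B : Set ((Idx L W → ℂ) × (Idx L W → ℂ)) :=
    {p | b * ∑ x ∈ Finset.univ.erase i, varS L W i x * ‖p.2 x‖ ^ 2 <
      ‖∑ x ∈ Finset.univ.erase i, p.1 x * p.2 x‖ ^ 2}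
  have hB : MeasurableSet B := by
    refine measurableSet_lt ?_ ?_
    · fun_prop
    · fun_prop
  have h1 := measureReal_le_of_indepFun hrow hFm hind hB
    (C := 4 * Real.exp (-(b / 2))) (by positivity) (fun y => ?_)
  · refine (measureReal_mono (fun ω hω => ?_) (by finiteness)).trans h1
    have hz0 : F (cutMatrix (H ω) i) i = 0 := by
      simp only [F, ← hK]
      exact chain_minor_row (hne ω) s l k
    simp only [Set.mem_ofPred_eq, hK ω] at hω
    change b * ∑ x, varS L W i x * ‖F (cutMatrix (H ω) i) x‖ ^ 2 <
      ‖∑ x, H ω i x * F (cutMatrix (H ω) i) x‖ ^ 2 at hω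
    rw [← Finset.add_sum_erase _ _ (Finset.mem_univ i),
      ← Finset.add_sum_erase _ (fun x => H ω i x * F (cutMatrix (H ω) i) x)
        (Finset.mem_univ i), hz0] at hω
    simpa [B] using hω
  -- With the chain of minors frozen, this is a linear form in Gaussians of variance t S_ix, and t ≤
  -- 1 allows S_ix as the bound.
  · refine measureReal_linear_form_le (hH.iIndepFun_row i)
      (v := fun u => (t * varS L W i u).toNNReal) (V := varS L W i) ?_ ?_ y hb
    · intro u hu
      exact hH.law_offDiag i u (Finset.ne_of_mem_erase hu).symm
    · intro u _
      have h0 : 0 ≤ varS L W i u := by unfold varS; split_ifs <;> positivity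
      rw [Real.coe_toNNReal _ (by positivity)]
      nlinarith

end RowConcentration

/-! ### Union bound over all rows and chains -/

section UnionBound

variable {L W : ℕ} [NeZero L] {t : ℝ} {Ω : Type*} [MeasurableSpace Ω] {P : Measure Ω}
  [IsProbabilityMeasure P] {H : Ω → Matrix (Idx L W) (Idx L W) ℂ}

/-- Simultaneous concentration of all rows of `H` against all chains of at most `n` minors. -/
theorem IsBandMatrixAt.rows_concentration (hH : IsBandMatrixAt L W t P H) (ht : 0 ≤ t)
    (ht' : t ≤ 1) (hW : 0 < W) {z : ℂ} (hz : z.im ≠ 0) (n : ℕ) {b : ℝ} (hb : 0 ≤ b) :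
    P.real {ω | ¬ ∀ i k, k ≠ i → ∀ s (l : List (ZMod L × Bool)), l.length < n →
      ‖∑ x, H ω i x * chain (weightE (blockWeight L W))
        (minor (green L W (H ω) z) i) s l x k‖ ^ 2 ≤
      b * ∑ x, varS L W i x * ‖chain (weightE (blockWeight L W))
        (minor (green L W (H ω) z) i) s l x k‖ ^ 2} ≤
      8 * n * 2 ^ n * ((W * L : ℕ) : ℝ) ^ (n + 2) * Real.exp (-(b / 2)) := by
  -- Chains of length below n form a finite family, of cardinality polynomial in N because L ≤ N and
  -- n is fixed.
  let J := Idx L W × Idx L W × Bool × (Σ p : Fin n, List.Vector (ZMod L × Bool) p)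
  let A : J → Set Ω := fun j => {ω | b * ∑ x, varS L W j.1 x *
        ‖chain (weightE (blockWeight L W)) (minor (green L W (H ω) z) j.1) j.2.2.1
          j.2.2.2.2.1 x j.2.1‖ ^ 2 <
      ‖∑ x, H ω j.1 x * chain (weightE (blockWeight L W))
        (minor (green L W (H ω) z) j.1) j.2.2.1 j.2.2.2.2.1 x j.2.1‖ ^ 2}
  have hA : ∀ j, P.real (A j) ≤ 4 * Real.exp (-(b / 2)) := fun j =>
    hH.row_concentration ht ht' hz j.1 j.2.1 j.2.2.1 j.2.2.2.2.1 hb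
  have hL : 0 < L := Nat.pos_of_ne_zero (NeZero.ne L)
  have hLN : (L : ℝ) ≤ ((W * L : ℕ) : ℝ) := by
    exact_mod_cast Nat.le_mul_of_pos_left L hW
  have hN1 : (1 : ℝ) ≤ ((W * L : ℕ) : ℝ) := by
    exact_mod_cast Nat.mul_pos hW hL
  have hcard : (Fintype.card J : ℝ) ≤ 2 * n * 2 ^ n * ((W * L : ℕ) : ℝ) ^ (n + 2) := by
    have h1 : Fintype.card J = (L * W) * ((L * W) * (2 * ∑ p : Fin n, (L * 2) ^ (p : ℕ))) := by
      simp [J, Fintype.card_prod, Fintype.card_sigma, ZMod.card, card_vector]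
    have h2 : ((∑ p : Fin n, (L * 2) ^ (p : ℕ) : ℕ) : ℝ) ≤
        n * (2 * ((W * L : ℕ) : ℝ)) ^ n := by
      push_cast
      calc _ ≤ ∑ _p : Fin n, (2 * ((W : ℝ) * L)) ^ n := by
            refine Finset.sum_le_sum fun p _ => ?_
            have h3 : (L : ℝ) * 2 ≤ 2 * ((W : ℝ) * L) := by
              push_cast at hLN
              linarith
            refine (pow_le_pow_left₀ (by positivity) h3 _).trans ?_
            refine pow_le_pow_right₀ ?_ p.2.le
            push_cast at hN1
            linarith
        _ = _ := by simp
    have h3 : (Fintype.card J : ℝ) = ((W * L : ℕ) : ℝ) * (((W * L : ℕ) : ℝ) *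
        (2 * ((∑ p : Fin n, (L * 2) ^ (p : ℕ) : ℕ) : ℝ))) := by
      rw [h1]
      push_cast
      ring
    rw [h3]
    calc _ ≤ ((W * L : ℕ) : ℝ) * (((W * L : ℕ) : ℝ) *
          (2 * (n * (2 * ((W * L : ℕ) : ℝ)) ^ n))) := by gcongr
      _ = _ := by
        rw [mul_pow]
        ring
  have hsub : {ω | ¬ ∀ i k, k ≠ i → ∀ s (l : List (ZMod L × Bool)), l.length < n →
      ‖∑ x, H ω i x * chain (weightE (blockWeight L W))
        (minor (green L W (H ω) z) i) s l x k‖ ^ 2 ≤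
      b * ∑ x, varS L W i x * ‖chain (weightE (blockWeight L W))
        (minor (green L W (H ω) z) i) s l x k‖ ^ 2} ⊆ ⋃ j, A j := by
    intro ω hω
    simp only [Set.mem_ofPred_eq] at hω
    push Not at hω
    obtain ⟨i, k, _, s, l, hl, h⟩ := hω
    exact Set.mem_iUnion.2 ⟨(i, k, s, ⟨⟨l.length, hl⟩, ⟨l, rfl⟩⟩), h⟩
  refine (measureReal_mono hsub (by finiteness)).trans ?_
  refine (measureReal_iUnion_fintype_le A).trans ?_
  refine (Finset.sum_le_sum fun j _ => hA j).trans ?_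
  rw [Finset.sum_const, nsmul_eq_mul, Finset.card_univ]
  calc _ ≤ 2 * n * 2 ^ n * ((W * L : ℕ) : ℝ) ^ (n + 2) * (4 * Real.exp (-(b / 2))) := by gcongr
    _ = _ := by ring

end UnionBound

/-! ### Asymptotics in the matrix size -/

section Asymptotics

/-- The threshold in the definition is uniform over members of equal size, so domination becomes an
eventual statement in the size, and finitely many such statements can be intersected. -/
theorem stochDom_iff {ι : Type*} {Ω : ι → Type*} [∀ i, MeasurableSpace (Ω i)]
    {P : ∀ i, Measure (Ω i)} {N : ι → ℕ} {ξ ζ : ∀ i, Ω i → ℝ} :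
    StochDom P N ξ ζ ↔ ∀ τ : ℝ, 0 < τ → ∀ D : ℝ, 0 < D → ∀ᶠ k : ℕ in atTop, ∀ i, N i = k →
      (P i).real {ω | ξ i ω > (N i : ℝ) ^ τ * ζ i ω} ≤ (N i : ℝ) ^ (-D) := by
  refine forall_congr' fun τ => forall_congr' fun _ => forall_congr' fun D =>
    forall_congr' fun _ => ?_
  rw [eventually_atTop]
  refine exists_congr fun N₀ => ⟨fun h k hk i hi => h i (hi ▸ hk), fun h i hi => h _ hi i rfl⟩

theorem eventually_mul_rpow_neg_le {a : ℝ} (ha : 0 < a) (C : ℝ) {ε : ℝ} (hε : 0 < ε) :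
    ∀ᶠ k : ℕ in atTop, C * (k : ℝ) ^ (-a) ≤ ε := by
  have h := ((tendsto_rpow_neg_atTop ha).comp tendsto_natCast_atTop_atTop).const_mul C
  rw [mul_zero] at h
  exact (h.eventually (gt_mem_nhds hε)).mono fun k hk => hk.le

theorem eventually_le_rpow {a : ℝ} (ha : 0 < a) (C : ℝ) :
    ∀ᶠ k : ℕ in atTop, C ≤ (k : ℝ) ^ a :=
  ((tendsto_rpow_atTop ha).comp tendsto_natCast_atTop_atTop).eventually_ge_atTop C

theorem eventually_mul_exp_neg_rpow_le {a : ℝ} (ha : 0 < a) (C : ℝ) (m : ℕ) (D : ℝ) :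
    ∀ᶠ k : ℕ in atTop, C * (k : ℝ) ^ m * Real.exp (-((k : ℝ) ^ a / 2)) ≤ (k : ℝ) ^ (-D) := by
  have h1 := (tendsto_rpow_mul_exp_neg_mul_atTop_nhds_zero ((m + D) / a) (1 / 2)
    (by norm_num)).comp ((tendsto_rpow_atTop ha).comp tendsto_natCast_atTop_atTop)
  have h2 := h1.const_mul C
  rw [mul_zero] at h2
  filter_upwards [h2.eventually (gt_mem_nhds one_pos), eventually_ge_atTop 1] with k hk hk1
  have hk0 : (0 : ℝ) < k := by exact_mod_cast hk1
  simp only [Function.comp] at hk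
  rw [← Real.rpow_mul hk0.le, mul_div_cancel₀ _ ha.ne', Real.rpow_add hk0, Real.rpow_natCast,
    show -(1 / 2) * (k : ℝ) ^ a = -((k : ℝ) ^ a / 2) by ring] at hk
  have h3 : (k : ℝ) ^ (-D) * (k : ℝ) ^ D = 1 := by
    rw [← Real.rpow_add hk0, neg_add_cancel, Real.rpow_zero]
  have h4 : 0 < (k : ℝ) ^ (-D) := Real.rpow_pos_of_pos hk0 _
  calc _ = (k : ℝ) ^ (-D) * (C * ((k : ℝ) ^ m * (k : ℝ) ^ D *
        Real.exp (-((k : ℝ) ^ a / 2)))) := by linear_combination (-(C * (k : ℝ) ^ m *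
          Real.exp (-((k : ℝ) ^ a / 2)))) * h3
    _ ≤ (k : ℝ) ^ (-D) * 1 := by gcongr
    _ = _ := mul_one _

end Asymptotics

/-! ### The exceptional set and the conclusion -/

/-- The bounds on chains hold simultaneously with high probability. -/
theorem exists_exceptional_set {ι : Type*} {Ω : ι → Type*} [∀ i, MeasurableSpace (Ω i)]
    (P : ∀ i, Measure (Ω i)) [∀ i, IsProbabilityMeasure (P i)]
    (L W : ι → ℕ) [∀ i, NeZero (L i)] (E t : ι → ℝ)
    (H : ∀ i, Ω i → Matrix (Idx (L i) (W i)) (Idx (L i) (W i)) ℂ)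
    {c : ℝ} (hc : 0 < c)
    (hW : ∀ i, ((W i * L i : ℕ) : ℝ) ^ (1 / 2 : ℝ) ≤ (W i : ℝ))
    (hE : ∀ i, |E i| < 2)
    (ht : ∀ i, 0 ≤ t i) (ht' : ∀ i, t i < 1)
    (hH : ∀ i, IsBandMatrixAt (L i) (W i) (t i) (P i) (H i))
    (hG : StochDom P (fun i => W i * L i)
      (fun i ω => maxNorm (L i) (W i)
        (green (L i) (W i) (H i ω) (zFlow (E i) (t i)) true -
          mE (E i) • (1 : Matrix (Idx (L i) (W i)) (Idx (L i) (W i)) ℂ)))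
      (fun i _ => (W i : ℝ) ^ (-c)))
    {n : ℕ} (hn : 1 ≤ n) {α β : ι → ℝ}
    (hα : ∀ i, 1 ≤ α i) (hβ : ∀ i, 1 ≤ β i)
    (hαW : ∀ i, α i ^ 2 ≤ scale (L i) (W i) (E i) (t i) ^ (1 / 4 : ℝ))
    (hloop : ∀ m : ℕ, 2 ≤ m → m ≤ 2 * n →
      StochDom P (fun i => W i * L i)
        (fun i ω => XiLoop (L i) (W i) (H i ω) (E i) (t i) m)
        (fun i _ => fBound m (α i) (β i)))
    {τ D : ℝ} (hτ : 0 < τ) (hD : 0 < D) :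
    ∀ᶠ k : ℕ in atTop, ∀ i, W i * L i = k → ∃ A : Set (Ω i), (P i).real A ≤ (k : ℝ) ^ (-D) ∧
      ∀ ω ∉ A,
        XiOff (L i) (W i) (H i ω) (E i) (t i) n ≤
          (k : ℝ) ^ τ * fBound (2 * n) (α i) (β i) ^ (1 / 2 : ℝ) ∧
        XiDiag (L i) (W i) (H i ω) (E i) (t i) (2 * n) ≤
          (k : ℝ) ^ τ * fBound (2 * n) (α i) (β i) := by
  set e : ℕ := 9 ^ (n + n) with he
  -- With B = k^θ, the first bound makes B^e ≤ k^τ. The other two make ε² B³ ≤ k^(5θ - c) and W⁻¹ B³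
  -- ≤ k^(3θ - 1/2) decay, which gives δ B³ ≤ 1/2.
  obtain ⟨θ, hθ, hθτ, hθc, hθ1⟩ : ∃ θ : ℝ, 0 < θ ∧ θ * e ≤ τ ∧ θ ≤ c / 10 ∧ θ ≤ 1 / 20 := by
    have he0 : (0 : ℝ) < e := by rw [he]; positivity
    refine ⟨min (τ / e) (min (c / 10) (1 / 20)), by positivity, ?_,
      (min_le_right _ _).trans (min_le_left _ _), (min_le_right _ _).trans (min_le_right _ _)⟩
    rw [← le_div_iff₀ he0]
    exact min_le_left _ _
  rw [stochDom_iff] at hG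
  have hloop' : ∀ᶠ k : ℕ in atTop, ∀ m ∈ Finset.Icc 2 (2 * n), ∀ i, W i * L i = k →
      (P i).real {ω | XiLoop (L i) (W i) (H i ω) (E i) (t i) m >
        ((W i * L i : ℕ) : ℝ) ^ θ * fBound m (α i) (β i)} ≤
          ((W i * L i : ℕ) : ℝ) ^ (-(D + 1)) := by
    rw [Filter.eventually_all_finset]
    intro m hm
    rw [Finset.mem_Icc] at hm
    exact stochDom_iff.1 (hloop m hm.1 hm.2) θ hθ (D + 1) (by linarith)
  filter_upwards [hG θ hθ (D + 1) (by linarith), hloop',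
    eventually_le_rpow hθ (100 * ((n : ℝ) + 1)),
    eventually_mul_rpow_neg_le (a := c / 10) (by positivity) 1 (ε := 1 / 2) (by norm_num),
    eventually_mul_rpow_neg_le (a := c / 10) (by positivity) 1 (ε := 1 / 4) (by norm_num),
    eventually_mul_rpow_neg_le (a := 1 / 10) (by norm_num) 4 (ε := 1 / 4) (by norm_num),
    eventually_mul_rpow_neg_le (a := 1) (by norm_num) (2 * n + 2) (ε := 1) (by norm_num),
    eventually_mul_exp_neg_rpow_le hθ (8 * n * 2 ^ n) (n + 2) (D + 1), eventually_ge_atTop 1]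
    with k hGk hLk hk1 hk2 hk3 hk4 hk5 hk6 hk7 i hi
  have hk0 : (0 : ℝ) < k := by exact_mod_cast hk7
  have hk1' : (1 : ℝ) ≤ k := by exact_mod_cast hk7
  have hGi := hGk i hi
  have hLi := fun m hm => hLk m hm i hi
  have hWi := hW i
  simp only [hi] at hGi hLi hWi
  have hWpos : 0 < W i := Nat.pos_of_ne_zero fun h0 => by simp [h0] at hi; omega
  have hW' : (0 : ℝ) < W i := by exact_mod_cast hWpos
  have hz : (zFlow (E i) (t i)).im ≠ 0 := by
    have h1 := etaFlow_eq (E i) (t i)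
    rw [etaFlow] at h1
    rw [h1]
    have := mE_im_pos (hE i)
    have : 0 < 1 - t i := by linarith [ht' i]
    positivity
  have hB0 : 0 ≤ (k : ℝ) ^ θ := Real.rpow_nonneg hk0.le _
  have hLDE := (hH i).rows_concentration (ht i) (ht' i).le hWpos hz n hB0
  rw [hi] at hLDE
  refine ⟨{ω | maxNorm (L i) (W i) (green (L i) (W i) (H i ω) (zFlow (E i) (t i)) true -
      mE (E i) • (1 : Matrix (Idx (L i) (W i)) (Idx (L i) (W i)) ℂ)) >
        (k : ℝ) ^ θ * (W i : ℝ) ^ (-c)} ∪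
    ((⋃ m ∈ Finset.Icc 2 (2 * n), {ω | XiLoop (L i) (W i) (H i ω) (E i) (t i) m >
        (k : ℝ) ^ θ * fBound m (α i) (β i)}) ∪
    {ω | ¬ ∀ j u, u ≠ j → ∀ s (l : List (ZMod (L i) × Bool)), l.length < n →
      ‖∑ x, H i ω j x * chain (weightE (blockWeight (L i) (W i)))
        (minor (green (L i) (W i) (H i ω) (zFlow (E i) (t i))) j) s l x u‖ ^ 2 ≤
      (k : ℝ) ^ θ * ∑ x, varS (L i) (W i) j x * ‖chain (weightE (blockWeight (L i) (W i)))
        (minor (green (L i) (W i) (H i ω) (zFlow (E i) (t i))) j) s l x u‖ ^ 2}), ?_, ?_⟩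
  -- Fewer than 2n + 2 events are united; each was estimated with D + 1, and the spare factor k⁻¹
  -- absorbs their number.
  · have h1 : (k : ℝ) ^ (-(D + 1)) = (k : ℝ) ^ (-(1 : ℝ)) * (k : ℝ) ^ (-D) := by
      rw [← Real.rpow_add hk0]
      congr 1
      ring
    refine (measureReal_union_le _ _).trans ((add_le_add hGi ((measureReal_union_le _ _).trans
      (add_le_add ((measureReal_biUnion_finset_le _ _).trans (Finset.sum_le_sum hLi))
        (hLDE.trans hk6)))).trans ?_)
    rw [Finset.sum_const, Nat.card_Icc, nsmul_eq_mul, h1]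
    have h2 : ((2 * n + 1 - 2 : ℕ) : ℝ) ≤ 2 * n := by
      exact_mod_cast (by omega : 2 * n + 1 - 2 ≤ 2 * n)
    have h3 : 0 ≤ (k : ℝ) ^ (-(1 : ℝ)) := Real.rpow_nonneg hk0.le _
    have h4 : 0 ≤ (k : ℝ) ^ (-D) := Real.rpow_nonneg hk0.le _
    calc _ ≤ (k : ℝ) ^ (-(1 : ℝ)) * (k : ℝ) ^ (-D) + (2 * n * ((k : ℝ) ^ (-(1 : ℝ)) *
          (k : ℝ) ^ (-D)) + (k : ℝ) ^ (-(1 : ℝ)) * (k : ℝ) ^ (-D)) := by gcongr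
      _ = ((2 * n + 2) * (k : ℝ) ^ (-(1 : ℝ))) * (k : ℝ) ^ (-D) := by ring
      _ ≤ 1 * (k : ℝ) ^ (-D) := by gcongr
      _ = _ := one_mul _
  · intro ω hω
    simp only [Set.mem_union, Set.mem_iUnion, Set.mem_ofPred_eq, not_or, not_exists, not_lt,
      gt_iff_lt, not_not] at hω
    obtain ⟨hω1, hω2, hω3⟩ := hω
    have hs : 1 ≤ scale (L i) (W i) (E i) (t i) :=
      one_le_of_one_le_rpow (scale_nonneg (hE i) (ht' i)) (by nlinarith [hα i, hαW i])
    have hWc : (W i : ℝ) ^ (-c) ≤ (k : ℝ) ^ (-(c / 2)) := by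
      calc (W i : ℝ) ^ (-c) ≤ ((k : ℝ) ^ (1 / 2 : ℝ)) ^ (-c) :=
            Real.rpow_le_rpow_of_nonpos (by positivity) hWi (by linarith)
        _ = _ := by
          rw [← Real.rpow_mul hk0.le]
          congr 1
          ring
    have hWinv : (W i : ℝ)⁻¹ ≤ (k : ℝ) ^ (-(1 / 2) : ℝ) := by
      rw [Real.rpow_neg hk0.le]
      exact inv_anti₀ (by positivity) hWi
    have hε : (k : ℝ) ^ θ * (W i : ℝ) ^ (-c) ≤ (k : ℝ) ^ (θ - c / 2) := by
      rw [sub_eq_add_neg, Real.rpow_add hk0]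
      gcongr
    have hpow : ∀ m : ℕ, ((k : ℝ) ^ θ) ^ m = (k : ℝ) ^ (θ * m) := fun m => by
      rw [← Real.rpow_natCast, ← Real.rpow_mul hk0.le]
    have hgood := goodSample ((hH i).isHermitian ω) hWpos (hE i) (ht i) (ht' i) (hα i) (hβ i)
      (hαW i) (B := (k : ℝ) ^ θ) (ε := (k : ℝ) ^ θ * (W i : ℝ) ^ (-c)) (n := n) hk1 ?_ ?_ hω1 ?_
      hω3
    · have hB1 : 1 ≤ (k : ℝ) ^ θ := Real.one_le_rpow hk1' hθ.le
      have hexp : ∀ m, m ≤ e → ((k : ℝ) ^ θ) ^ m ≤ (k : ℝ) ^ τ := fun m hm => by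
        refine (pow_le_pow_right₀ hB1 hm).trans ?_
        rw [hpow]
        exact Real.rpow_le_rpow_of_exponent_le hk1' hθτ
      have hf := fBound_nonneg (hα i) (hβ i) (2 * n)
      refine ⟨(XiOff_le hn (hα i) (hβ i) (by linarith) hgood).trans ?_,
        (XiDiag_le hn (hα i) (hβ i) (by linarith) hgood).trans ?_⟩
      · exact mul_le_mul_of_nonneg_right (hexp _ le_rfl) (by positivity)
      · exact mul_le_mul_of_nonneg_right
          (hexp _ (Nat.pow_le_pow_right (by norm_num) (by omega))) hf
    · refine hε.trans (le_trans ?_ hk2)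
      rw [one_mul]
      exact Real.rpow_le_rpow_of_exponent_le hk1' (by linarith)
    · rw [add_mul, hpow]
      have h1 : ((k : ℝ) ^ θ * (W i : ℝ) ^ (-c)) ^ 2 * (k : ℝ) ^ (θ * (3 : ℕ)) ≤ 1 / 4 := by
        calc _ ≤ ((k : ℝ) ^ (θ - c / 2)) ^ 2 * (k : ℝ) ^ (θ * (3 : ℕ)) := by gcongr
          _ = (k : ℝ) ^ ((θ - c / 2) * (2 : ℕ) + θ * (3 : ℕ)) := by
            rw [Real.rpow_add hk0, Real.rpow_mul hk0.le (θ - c / 2), Real.rpow_natCast]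
          _ ≤ 1 * (k : ℝ) ^ (-(c / 10)) := by
            rw [one_mul]
            refine Real.rpow_le_rpow_of_exponent_le hk1' ?_
            push_cast
            linarith
          _ ≤ _ := hk3
      have h2 : 4 * (W i : ℝ)⁻¹ * (k : ℝ) ^ (θ * (3 : ℕ)) ≤ 1 / 4 := by
        calc _ ≤ 4 * (k : ℝ) ^ (-(1 / 2) : ℝ) * (k : ℝ) ^ (θ * (3 : ℕ)) := by gcongr
          _ = 4 * (k : ℝ) ^ (-(1 / 2) + θ * (3 : ℕ)) := by
            rw [Real.rpow_add hk0, mul_assoc]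
          _ ≤ 4 * (k : ℝ) ^ (-(1 / 10) : ℝ) := by
            refine mul_le_mul_of_nonneg_left
              (Real.rpow_le_rpow_of_exponent_le hk1' ?_) (by norm_num)
            push_cast
            linarith
          _ ≤ _ := hk4
      linarith
    · exact fun m h2 hm => hω2 m (Finset.mem_Icc.2 ⟨h2, hm⟩)

end BandMatrix

theorem lemma4p3 {ι : Type*} {Ω : ι → Type*} [∀ i, MeasurableSpace (Ω i)]
    (P : ∀ i, Measure (Ω i)) [∀ i, IsProbabilityMeasure (P i)]
    (L W : ι → ℕ) [∀ i, NeZero (L i)] (E t : ι → ℝ)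
    (H : ∀ i, Ω i → Matrix (Idx (L i) (W i)) (Idx (L i) (W i)) ℂ)
    (κ c₀ c : ℝ) (hκ : 0 < κ) (hc₀ : 0 < c₀) (hc : 0 < c)
    (hL : ∀ i, 3 ≤ L i)
    (hW : ∀ i, ((W i * L i : ℕ) : ℝ) ^ (1 / 2 + c₀) ≤ (W i : ℝ))
    (hE : ∀ i, |E i| < 2 - κ)
    (ht : ∀ i, 0 ≤ t i) (ht' : ∀ i, t i < 1)
    (hH : ∀ i, IsBandMatrixAt (L i) (W i) (t i) (P i) (H i))
    (hG : StochDom P (fun i => W i * L i)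
      (fun i ω => maxNorm (L i) (W i)
        (green (L i) (W i) (H i ω) (zFlow (E i) (t i)) true -
          mE (E i) • (1 : Matrix (Idx (L i) (W i)) (Idx (L i) (W i)) ℂ)))
      (fun i _ => (W i : ℝ) ^ (-c)))
    (n : ℕ) (hn : 1 ≤ n) (α β : ι → ℝ)
    (hα : ∀ i, 1 ≤ α i) (hβ : ∀ i, 1 ≤ β i)
    (hαW : ∀ i, α i ^ 2 ≤ scale (L i) (W i) (E i) (t i) ^ (1 / 4 : ℝ))
    (hloop : ∀ m : ℕ, 2 ≤ m → m ≤ 2 * n →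
      StochDom P (fun i => W i * L i)
        (fun i ω => XiLoop (L i) (W i) (H i ω) (E i) (t i) m)
        (fun i _ => fBound m (α i) (β i))) :
    StochDom P (fun i => W i * L i)
        (fun i ω => XiOff (L i) (W i) (H i ω) (E i) (t i) n)
        (fun i _ => fBound (2 * n) (α i) (β i) ^ (1 / 2 : ℝ)) ∧
      StochDom P (fun i => W i * L i)
        (fun i ω => XiDiag (L i) (W i) (H i ω) (E i) (t i) (2 * n))
        (fun i _ => fBound (2 * n) (α i) (β i)) := by

  have hE2 : ∀ i, |E i| < 2 := fun i => (hE i).trans (by linarith)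
  have hW2 : ∀ i, ((W i * L i : ℕ) : ℝ) ^ (1 / 2 : ℝ) ≤ (W i : ℝ) := by
    intro i
    -- Lowering the exponent needs a base of at least 1, so a member with W = 0 is treated apart.
    rcases Nat.eq_zero_or_pos (W i * L i) with h | h
    · rw [h, Nat.cast_zero, Real.zero_rpow (by norm_num)]
      positivity
    · have h1 : (1 : ℝ) ≤ ((W i * L i : ℕ) : ℝ) := by exact_mod_cast h
      exact (Real.rpow_le_rpow_of_exponent_le h1 (by linarith)).trans (hW i)
  rw [stochDom_iff, stochDom_iff]
  refine ⟨fun τ hτ D hD => ?_, fun τ hτ D hD => ?_⟩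
  all_goals
    filter_upwards [exists_exceptional_set P L W E t H hc hW2 hE2 ht ht' hH hG hn hα hβ hαW hloop
      hτ hD] with k hk i hi
    obtain ⟨A, hA, h⟩ := hk i hi
    simp only [hi]
    refine (measureReal_mono (fun ω hω => ?_) (by finiteness)).trans hA
    by_contra hωA
  · exact absurd (h ω hωA).1 (not_le.2 hω)
  · exact absurd (h ω hωA).2 (not_le.2 hω)
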